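/- **Theorem (Local Polynomial Smoothing under uniform random design).** For $\beta>0$ let $l$ be the largest integer strictly less than $\beta$, and let $\Sigma(\beta,L)$ be the class of all functions $f$ on $[0,1]$ that are $l$ times differentiable with $|f^{(l)}(x)-f^{(l)}(y)|\le L|x-y|^{\beta-l}$ for all $x,y\in[0,1]$. *Data and estimator.* Let $y_i=f(x_i)+z_i$, $i=1,\dots,n$, where $x_1,\dots,x_n,z_1,\dots,z_n$ are independent, each $x_i$ is uniform on $[0,1]$ and each $z_i$ is $\mathcal N(0,\sigma^2)$. Let $x_{(1)}\le\dots\le x_{(n)}$ be the order statistics of the design, let $y_{(i)}$ denote the response observed at $x_{(i)}$, and put $\delta_i=i/(n+1)$ and $U(u)=(1,u,u^2/2!,\dots,u^l/l!)^{T}$. For a kernel $K$ and a bandwidth $h>0$ define $$\hat\theta(t)=\arg\min_{\theta\in\mathbb R^{l+1}}\ \sum_{i=1}^n\Big\{y_{(i)}-\theta^{T}U\Big(\frac{\delta_i-t}{h}\Big)\Big\}^2K\Big(\frac{\delta_i-t}{h}\Big),\qquad \hat f(t)=U(0)^{T}\hat\theta(t).$$ Write $\|g\|_n^2=\frac1n\sum_{i=1}^n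 g(x_i)^2$. *Claim.* Let $\beta\ge 1/2$ and $0<c_1\le c_2$. Let $K:\mathbb R\to\mathbb R$ be a measurable, nonnegative, bounded function that vanishes outside $[-1,1]$ and satisfies $K(u)\ge K_{\min}$ for $|u|\le\Delta$, for some $K_{\min}>0$ and $\Delta>0$. Then there is $n_0\ge1$, depending only on $\beta,K,c_1,c_2$, such that the following hold for all $n\ge n_0$ and all $h$ with $c_1n^{-1/(2\beta+1)}\le h\le c_2n^{-1/(2\beta+1)}$. 1. The minimizer $\hat\theta(t)$ exists and is unique for every $t\in[0,1]$ and every vector of responses. 2. For all $L$, $B$ and $\sigma\ge 0$ there is a constant $C>0$, depending only on $\beta,K,c_1,c_2,L,B,\sigma$ (and not on $n$, $h$ or $f$), such that for every $f\in\Sigma(\beta,L)$, with in addition $\sup_{[0,1]}|f|\le B$ if $\beta>1$, the loss $\|\hat f-f\|_n^2$ is integrable and $$E\,\|\hat f-f\|_n^2\ \le\ C\,n^{-2\beta/(1+2\beta)}.$$ -/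

import Mathlib

open MeasureTheory ProbabilityTheory Set
open scoped NNReal

/-- The largest integer strictly less than `β`, for `β > 0`. -/
noncomputable def strictFloor (β : ℝ) : ℕ := ⌈β⌉₊ - 1

/-- The Hölder class `Σ(β, L)` on `[0, 1]`: the functions that are `l` times differentiable on
`[0, 1]`, where `l` is the largest integer strictly less than `β`, and whose `l`-th derivative
is Hölder continuous there with exponent `β - l` and constant `L`. -/
def holderClass (β L : ℝ) : Set (ℝ → ℝ) :=
  {f | (∀ k < strictFloor β,
        DifferentiableOn ℝ (iteratedDerivWithin k f (Icc 0 1)) (Icc 0 1)) ∧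
      ∀ x ∈ Icc (0 : ℝ) 1, ∀ y ∈ Icc (0 : ℝ) 1,
        |iteratedDerivWithin (strictFloor β) f (Icc 0 1) x
            - iteratedDerivWithin (strictFloor β) f (Icc 0 1) y|
          ≤ L * |x - y| ^ (β - (strictFloor β : ℝ))}

/-- The standard conditions on the kernel of a local polynomial estimator: measurable, nonnegative,
bounded, supported in `[-1, 1]`, and bounded below by a positive constant near `0`. -/
structure IsLocalPolyKernel (K : ℝ → ℝ) : Prop where
  measurable : Measurable K
  nonneg : ∀ u, 0 ≤ K u
  support : ∀ u, 1 < |u| → K u = 0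
  bounded : ∃ Kmax : ℝ, ∀ u, |K u| ≤ Kmax
  lower : ∃ Kmin > (0 : ℝ), ∃ Δ > (0 : ℝ), ∀ u, |u| ≤ Δ → Kmin ≤ K u

/-- `U(u) = (1, u, u² / 2, …, u ^ l / l!)`. -/
noncomputable def monomialVec (l : ℕ) (u : ℝ) : Fin (l + 1) → ℝ :=
  fun k => u ^ (k : ℕ) / (Nat.factorial k : ℝ)

/-- The pretended design points `δ_i = i / (n + 1)` for `i = 1, …, n`
(the index `i : Fin n` starts at `0`). -/
noncomputable def pseudoDesign (n : ℕ) (i : Fin n) : ℝ := ((i : ℝ) + 1) / ((n : ℝ) + 1)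

/-- The weighted least squares criterion at the point `t` for the observations `(δ_i, y_i)`. -/
noncomputable def localPolyCriterion (l : ℕ) (K : ℝ → ℝ) (h : ℝ) {n : ℕ} (y : Fin n → ℝ)
    (t : ℝ) (θ : Fin (l + 1) → ℝ) : ℝ :=
  ∑ i : Fin n,
    (y i - θ ⬝ᵥ monomialVec l ((pseudoDesign n i - t) / h)) ^ 2
      * K ((pseudoDesign n i - t) / h)

/-- `θ` minimizes the local least squares criterion at `t`. -/
def IsLocalPolyFit (l : ℕ) (K : ℝ → ℝ) (h : ℝ) {n : ℕ} (y : Fin n → ℝ) (t : ℝ)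
    (θ : Fin (l + 1) → ℝ) : Prop :=
  ∀ θ' : Fin (l + 1) → ℝ, localPolyCriterion l K h y t θ ≤ localPolyCriterion l K h y t θ'

/-- The local polynomial estimate `U(0)ᵀ θ̂(t)`, where `θ̂(t)` is a minimizer of the criterion
(some minimizer, if there are several). -/
noncomputable def localPolyEstimate (l : ℕ) (K : ℝ → ℝ) (h : ℝ) {n : ℕ} (y : Fin n → ℝ)
    (t : ℝ) : ℝ :=
  monomialVec l 0 ⬝ᵥ Classical.epsilon (fun θ => IsLocalPolyFit l K h y t θ)

/-- The modified estimator for the data `(x_i, y_i)`: the responses are relabelled along the order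
statistics `x_(1) ≤ … ≤ x_(n)` of the design, and `x_(i)` is replaced by `δ_i`. -/
noncomputable def modifiedLocalPoly (l : ℕ) (K : ℝ → ℝ) (h : ℝ) {n : ℕ} (x y : Fin n → ℝ)
    (t : ℝ) : ℝ :=
  localPolyEstimate l K h (fun i => y (Tuple.sort x i)) t

/-- `‖g‖_n² = n⁻¹ ∑ g(x_i)²`. -/
noncomputable def empiricalNormSq {n : ℕ} (x : Fin n → ℝ) (g : ℝ → ℝ) : ℝ :=
  (1 / (n : ℝ)) * ∑ i : Fin n, g (x i) ^ 2

/-!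
The local polynomial estimate is linear in the responses, `∑ i, W i (t) * y_(i)`, with weights
that depend only on the pretended design `δ_i = i / (n + 1)` and vanish when `|δ_i - t| > h`.

The criterion is coercive: within `h` of any `t ∈ [0, 1]` there are of the order of `n * h` points
`δ_i`, which can be grouped into families of `l + 1` points with equal spacing comparable to `h`,
and the values of a polynomial of degree at most `l` at such a family control its coefficients, by
compactness (`exists_pos_le_sum_sq_dotProduct_monomialVec`, `exists_pos_mul_le_sum_sq_mul_kernel`).
Hence the minimizer is unique, the weights reproduce polynomials of degree at most `l`, and
`∑ i, W i (t) ^ 2` is of order `1 / (n * h)` (`sum_leastSquaresWeight_sq_le`).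

The error at `t` is the sum of three terms (`sq_localPolyEstimate_sub_le`).
* The noise `∑ i, W i (t) * z_(i)`. At a design point the weights depend on the design only, so the
  second moment is that of independent errors, of order `1 / (n * h)`
  (`integrable_sq_sum_mul_and_integral_le`).
* The approximation error `∑ i, W i (t) * (f (δ_i) - T (δ_i))`, with `T` the Taylor polynomial of
  `f` at `t`, of order `h ^ β`.
* The design error `∑ i, W i (t) * (f (x_(i)) - f (δ_i))`. The functions considered share a Hölder
  modulus with exponent `γ = min β 1`; for `1 < β` this is where the bound on `|f|` enters
  (`exists_abs_sub_le_of_mem_holderClass`). By the Cauchy–Schwarz inequality, the average over the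
  design points of the squared design error is at most of the order of
  `(n * h)⁻¹ * n⁻¹ * ∑ i, N i * |x_(i) - δ_i| ^ (2 * γ)`, where `N i` counts the design points
  within `h` of `δ_i`. Although `N i` and `x_(i)` are dependent, their moments suffice:
  `N i` has second moment of order `(n * h) ^ 2` and `x_(i) - δ_i` has fourth moment of order
  `n ^ (-2)`, by Hoeffding's inequality (`IsUniformSample.integral_orderStatistic_le`). So the
  design error contributes `n ^ (-γ)` to the risk.

For `h` of the order of `n ^ (-1 / (2 * β + 1))` the first two contributions are of the order of
`n ^ (-2 * β / (2 * β + 1))`, and so is the third as soon as `1 / 2 ≤ β` (`risk_bound_le_rate`).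
-/

/-! ### Polynomials at equally spaced points -/

theorem monomialVec_dotProduct (l : ℕ) (u : ℝ) (v : Fin (l + 1) → ℝ) :
    v ⬝ᵥ monomialVec l u = ∑ k : Fin (l + 1), v k * (u ^ (k : ℕ) / (Nat.factorial k : ℝ)) := rfl

theorem monomialVec_zero_dotProduct (l : ℕ) (v : Fin (l + 1) → ℝ) :
    monomialVec l 0 ⬝ᵥ v = v 0 := by
  rw [dotProduct, Fin.sum_univ_succ]
  simp [monomialVec]

/-- A polynomial of degree at most `l` with `l + 1` distinct roots is zero. -/
theorem eq_zero_of_dotProduct_monomialVec_eq_zero {l : ℕ} {τ w : ℝ} (hw : w ≠ 0)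
    {v : Fin (l + 1) → ℝ} (hv : ∀ a : Fin (l + 1), v ⬝ᵥ monomialVec l (τ + a * w) = 0) :
    v = 0 := by
  have hinj : Function.Injective (fun a : Fin (l + 1) => τ + (a : ℝ) * w) := by
    intro a b hab
    have : (a : ℝ) = b := mul_right_cancel₀ hw (add_left_cancel hab)
    exact Fin.ext (by exact_mod_cast this)
  have h0 : (fun k : Fin (l + 1) => v k / (Nat.factorial k : ℝ)) = 0 := by
    refine Matrix.eq_zero_of_mulVec_eq_zero (Matrix.det_vandermonde_ne_zero_iff.2 hinj) ?_
    ext a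
    rw [Pi.zero_apply, ← hv a, Matrix.mulVec, dotProduct, monomialVec_dotProduct]
    refine Finset.sum_congr rfl fun k _ => ?_
    rw [Matrix.vandermonde_apply]
    ring
  ext k
  have := congrFun h0 k
  simpa [Nat.factorial_ne_zero] using this

/-- The values of a polynomial of degree at most `l` at `l + 1` equally spaced points control its
coefficients, uniformly as long as the spacing stays away from `0` and the points stay bounded. -/
theorem exists_pos_le_sum_sq_dotProduct_monomialVec (l : ℕ) (R : ℝ) {w₀ : ℝ} (hw₀ : 0 < w₀) :
    ∃ c > 0, ∀ τ w : ℝ, |τ| ≤ R → w₀ ≤ w → w ≤ R → ∀ v : Fin (l + 1) → ℝ,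
      c * (v ⬝ᵥ v) ≤ ∑ a : Fin (l + 1), (v ⬝ᵥ monomialVec l (τ + a * w)) ^ 2 := by
  have hS : IsCompact {v : Fin (l + 1) → ℝ | v ⬝ᵥ v = 1} := by
    refine (isCompact_Icc (a := fun _ => (-1 : ℝ)) (b := fun _ => (1 : ℝ))).of_isClosed_subset
      (isClosed_eq (by unfold dotProduct; fun_prop) continuous_const) ?_
    intro v hv
    have h1 : ∀ k, v k * v k ≤ 1 := fun k => by
      rw [← (show v ⬝ᵥ v = 1 from hv)]
      exact Finset.single_le_sum (f := fun i => v i * v i)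
        (fun i _ => mul_self_nonneg (v i)) (Finset.mem_univ k)
    exact ⟨fun k => by nlinarith [h1 k], fun k => by nlinarith [h1 k]⟩
  have hK : IsCompact (Icc (-R) R ×ˢ Icc w₀ R ×ˢ {v : Fin (l + 1) → ℝ | v ⬝ᵥ v = 1}) :=
    isCompact_Icc.prod (isCompact_Icc.prod hS)
  obtain ⟨c, hc, hcK⟩ := hK.exists_forall_le' (a := (0 : ℝ))
    (f := fun p : ℝ × ℝ × (Fin (l + 1) → ℝ) =>
      ∑ a : Fin (l + 1), (p.2.2 ⬝ᵥ monomialVec l (p.1 + a * p.2.1)) ^ 2)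
    (by unfold dotProduct monomialVec; fun_prop)
    (by
      rintro ⟨τ, w, v⟩ ⟨-, hw, hv⟩
      refine lt_of_le_of_ne (Finset.sum_nonneg fun a _ => sq_nonneg _) fun h0 => ?_
      have h1 := (Finset.sum_eq_zero_iff_of_nonneg (fun a _ => sq_nonneg _)).1 h0.symm
      have h2 : v = 0 := eq_zero_of_dotProduct_monomialVec_eq_zero (hw₀.trans_le hw.1).ne'
        fun a => by simpa using h1 a (Finset.mem_univ a)
      have h3 : v ⬝ᵥ v = 1 := hv
      rw [h2] at h3
      simp at h3)
  refine ⟨c, hc, fun τ w hτ hw hwR v => ?_⟩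
  by_cases hv : v = 0
  · simp [hv]
  have hpos : 0 < v ⬝ᵥ v := by
    refine lt_of_le_of_ne (Finset.sum_nonneg fun i _ => mul_self_nonneg (v i)) fun h => hv ?_
    exact dotProduct_self_eq_zero.1 h.symm
  -- both sides are homogeneous of degree two, so `v` may be normalized
  set r := Real.sqrt (v ⬝ᵥ v) with hr
  have hr0 : 0 < r := Real.sqrt_pos.2 hpos
  have hr2 : r ^ 2 = v ⬝ᵥ v := Real.sq_sqrt hpos.le
  have key := hcK (τ, w, r⁻¹ • v) ⟨abs_le.1 hτ, ⟨hw, hwR⟩, by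
    simp only [mem_ofPred_eq, smul_dotProduct, dotProduct_smul, smul_eq_mul, ← hr2]
    field_simp⟩
  simp only [smul_dotProduct, smul_eq_mul, mul_pow, ← Finset.mul_sum] at key
  rw [← hr2]
  have := mul_le_mul_of_nonneg_left key (sq_nonneg r)
  rw [← mul_assoc, ← mul_pow, mul_inv_cancel₀ hr0.ne', one_pow, one_mul] at this
  linarith

/-! ### The Hölder class -/

/-- Taylor's formula with a Hölder remainder, for a function whose successive derivatives on
`[0, 1]` are `F 0, F 1, …, F l`. -/
theorem abs_sub_taylor_le {L a : ℝ} (ha : 0 < a) (hL : 0 ≤ L) (l : ℕ) (F : ℕ → ℝ → ℝ)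
    (hF : ∀ k < l, ∀ x ∈ Icc (0 : ℝ) 1, HasDerivWithinAt (F k) (F (k + 1) x) (Icc 0 1) x)
    (hl : ∀ x ∈ Icc (0 : ℝ) 1, ∀ y ∈ Icc (0 : ℝ) 1, |F l x - F l y| ≤ L * |x - y| ^ a)
    {t x : ℝ} (ht : t ∈ Icc (0 : ℝ) 1) (hx : x ∈ Icc (0 : ℝ) 1) :
    |F 0 x - ∑ k ∈ Finset.range (l + 1), F k t * ((x - t) ^ k / (Nat.factorial k : ℝ))|
      ≤ L * |x - t| ^ (a + l) := by
  induction l generalizing F x with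
  | zero => simpa using hl x hx t ht
  | succ l ih =>
    have IH := fun y hy => ih (x := y) (fun k => F (k + 1)) (fun k hk => hF (k + 1) (by omega)) hl hy
    set g : ℝ → ℝ := fun y =>
      F 0 y - ∑ k ∈ Finset.range (l + 1 + 1), F k t * ((y - t) ^ k / (Nat.factorial k : ℝ)) with hg
    have hsub : uIcc t x ⊆ Icc (0 : ℝ) 1 := uIcc_subset_Icc ht hx
    have hder : ∀ y ∈ uIcc t x, HasDerivWithinAt g
        (F 1 y - ∑ k ∈ Finset.range (l + 1), F (k + 1) t * ((y - t) ^ k / (Nat.factorial k : ℝ)))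
        (uIcc t x) y := by
      intro y hy
      refine ((hF 0 (by omega) y (hsub hy)).mono hsub).sub (HasDerivAt.hasDerivWithinAt ?_)
      simp_rw [Finset.sum_range_succ' _ (l + 1)]
      simp only [pow_zero]
      refine HasDerivAt.add_const _ (HasDerivAt.fun_sum fun k _ => HasDerivAt.const_mul _ ?_)
      have h1 := (((hasDerivAt_id y).sub_const t).pow (k + 1)).div_const
        (Nat.factorial (k + 1) : ℝ)
      refine h1.congr_deriv ?_
      have : (Nat.factorial k : ℝ) ≠ 0 := by exact_mod_cast Nat.factorial_ne_zero k
      simp only [id, Nat.add_sub_cancel, Nat.factorial_succ]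
      push_cast
      field_simp
    have hbound : ∀ y ∈ uIcc t x,
        ‖F 1 y - ∑ k ∈ Finset.range (l + 1), F (k + 1) t * ((y - t) ^ k / (Nat.factorial k : ℝ))‖
          ≤ L * |x - t| ^ (a + l) := by
      intro y hy
      refine (IH y (hsub hy)).trans (mul_le_mul_of_nonneg_left ?_ hL)
      exact Real.rpow_le_rpow (abs_nonneg _) (by
        simpa [abs_sub_comm] using abs_sub_left_of_mem_uIcc hy) (by positivity)
    have hmv := Convex.norm_image_sub_le_of_norm_hasDerivWithin_le hder hbound (convex_uIcc t x)
      left_mem_uIcc right_mem_uIcc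
    have hgt : g t = 0 := by
      simp [hg, Finset.sum_range_succ' _ (l + 1)]
    rw [hgt, sub_zero] at hmv
    refine hmv.trans (le_of_eq ?_)
    rw [Real.norm_eq_abs, mul_assoc]
    congr 1
    have : a + (↑(l + 1) : ℝ) = (a + l) + 1 := by push_cast; ring
    rw [this, Real.rpow_add_one' (abs_nonneg _) (by positivity)]

theorem strictFloor_lt {β : ℝ} (hβ : 0 < β) : (strictFloor β : ℝ) < β := by
  have h1 : 0 < ⌈β⌉₊ := Nat.ceil_pos.2 hβ
  have h2 := Nat.ceil_lt_add_one hβ.le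
  rw [strictFloor, Nat.cast_sub h1]
  push_cast
  linarith

theorem strictFloor_eq_zero {β : ℝ} (hβ : β ≤ 1) : strictFloor β = 0 := by
  have : ⌈β⌉₊ ≤ 1 := Nat.ceil_le.2 (by exact_mod_cast hβ)
  rw [strictFloor]
  omega

theorem strictFloor_pos {β : ℝ} (hβ : 1 < β) : 0 < strictFloor β := by
  have : 1 < ⌈β⌉₊ := Nat.lt_ceil.2 (by exact_mod_cast hβ)
  rw [strictFloor]
  omega

theorem holderClass_mono {β L L' : ℝ} (h : L ≤ L') : holderClass β L ⊆ holderClass β L' :=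
  fun _ hf => ⟨hf.1, fun x hx y hy => (hf.2 x hx y hy).trans
    (mul_le_mul_of_nonneg_right h (Real.rpow_nonneg (abs_nonneg _) _))⟩

theorem hasDerivWithinAt_of_mem_holderClass {β L : ℝ} {f : ℝ → ℝ} (hf : f ∈ holderClass β L)
    {k : ℕ} (hk : k < strictFloor β) {x : ℝ} (hx : x ∈ Icc (0 : ℝ) 1) :
    HasDerivWithinAt (iteratedDerivWithin k f (Icc 0 1))
      (iteratedDerivWithin (k + 1) f (Icc 0 1) x) (Icc 0 1) x := by
  rw [iteratedDerivWithin_succ]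
  exact (hf.1 k hk x hx).hasDerivWithinAt

/-- Near `t`, a function of the Hölder class is a polynomial in `(x - t) / h` of degree at most
`strictFloor β`, up to an error of order `|x - t| ^ β`. -/
theorem abs_sub_taylor_le_of_mem_holderClass {β L : ℝ} (hβ : 0 < β) (hL : 0 ≤ L) {f : ℝ → ℝ}
    (hf : f ∈ holderClass β L) {h : ℝ} (hh : h ≠ 0) {t x : ℝ} (ht : t ∈ Icc (0 : ℝ) 1)
    (hx : x ∈ Icc (0 : ℝ) 1) :
    |f x - (fun k : Fin (strictFloor β + 1) => iteratedDerivWithin k f (Icc 0 1) t * h ^ (k : ℕ))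
        ⬝ᵥ monomialVec (strictFloor β) ((x - t) / h)| ≤ L * |x - t| ^ β := by
  have h1 := abs_sub_taylor_le (sub_pos.2 (strictFloor_lt hβ)) hL (strictFloor β)
    (fun k => iteratedDerivWithin k f (Icc 0 1))
    (fun k hk x hx => hasDerivWithinAt_of_mem_holderClass hf hk hx) hf.2 ht hx
  rw [sub_add_cancel, iteratedDerivWithin_zero, Finset.sum_range] at h1
  rw [monomialVec_dotProduct]
  convert h1 using 4 with k
  rw [div_pow]
  field_simp

/-- A bounded function of the Hölder class with exponent larger than one has a bounded first
derivative: its Taylor polynomial at any point is bounded on `[0, 1]`, so its coefficients are. -/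
theorem exists_abs_iteratedDerivWithin_one_le {β L B : ℝ} (hβ : 1 < β) (hL : 0 ≤ L) :
    ∃ M : ℝ, ∀ f ∈ holderClass β L, (∀ t ∈ Icc (0 : ℝ) 1, |f t| ≤ B) →
      ∀ t ∈ Icc (0 : ℝ) 1, |iteratedDerivWithin 1 f (Icc 0 1) t| ≤ M := by
  set l := strictFloor β with hl
  have hl0 : 0 < l := strictFloor_pos hβ
  have hl' : (0 : ℝ) < (l : ℝ) + 1 := by positivity
  obtain ⟨c, hc, H⟩ := exists_pos_le_sum_sq_dotProduct_monomialVec l 1 (inv_pos.2 hl')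
  refine ⟨Real.sqrt (((l : ℝ) + 1) * (B + L) ^ 2 / c), fun f hf hB t ht => ?_⟩
  set v : Fin (l + 1) → ℝ := fun k => iteratedDerivWithin k f (Icc 0 1) t * 1 ^ (k : ℕ) with hv
  -- the equally spaced points `a / (l + 1)` of `[0, 1]`, seen from `t`
  have h1 := H (-t) ((l : ℝ) + 1)⁻¹ (abs_le.2 ⟨by linarith [ht.2], by linarith [ht.1]⟩) le_rfl
    (inv_le_one_of_one_le₀ (by linarith [(Nat.cast_nonneg l : (0 : ℝ) ≤ l)])) v
  have h2 : ∀ a : Fin (l + 1),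
      (v ⬝ᵥ monomialVec l (-t + a * ((l : ℝ) + 1)⁻¹)) ^ 2 ≤ (B + L) ^ 2 := by
    intro a
    have ha : (a : ℝ) * ((l : ℝ) + 1)⁻¹ ∈ Icc (0 : ℝ) 1 := by
      refine ⟨by positivity, ?_⟩
      rw [← div_eq_mul_inv, div_le_one hl']
      exact_mod_cast a.2.le
    have h3 := abs_sub_taylor_le_of_mem_holderClass (zero_lt_one.trans hβ) hL hf one_ne_zero ht ha
    have h4 : |(a : ℝ) * ((l : ℝ) + 1)⁻¹ - t| ^ β ≤ 1 :=
      Real.rpow_le_one (abs_nonneg _)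
        (abs_le.2 ⟨by linarith [ha.1, ht.2], by linarith [ha.2, ht.1]⟩) (by linarith)
    have h5 := mul_le_mul_of_nonneg_left h4 hL
    rw [div_one, show (a : ℝ) * ((l : ℝ) + 1)⁻¹ - t = -t + a * ((l : ℝ) + 1)⁻¹ by ring] at h3
    rw [show (a : ℝ) * ((l : ℝ) + 1)⁻¹ - t = -t + a * ((l : ℝ) + 1)⁻¹ by ring] at h5
    have h6 := abs_le.1 (h3.trans h5)
    have h7 := abs_le.1 (hB _ ha)
    exact sq_le_sq' (by linarith [h6.2, h7.1]) (by linarith [h6.1, h7.2])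
  have h3 := h1.trans (Finset.sum_le_sum fun a _ => h2 a)
  rw [Finset.sum_const, Finset.card_univ, Fintype.card_fin, nsmul_eq_mul] at h3
  push_cast at h3
  have h4 : v ⟨1, by omega⟩ * v ⟨1, by omega⟩ ≤ v ⬝ᵥ v :=
    Finset.single_le_sum (f := fun i => v i * v i) (fun i _ => mul_self_nonneg (v i))
      (Finset.mem_univ _)
  have h5 : v ⟨1, by omega⟩ = iteratedDerivWithin 1 f (Icc 0 1) t := by simp [hv]
  refine Real.abs_le_sqrt ?_
  rw [le_div_iff₀ hc, ← h5, sq, mul_comm]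
  exact (mul_le_mul_of_nonneg_left h4 hc.le).trans h3

/-- The functions considered share a Hölder modulus of continuity with exponent `min β 1`. -/
theorem exists_abs_sub_le_of_mem_holderClass {β L : ℝ} (B : ℝ) (hL : 0 ≤ L) :
    ∃ M : ℝ, ∀ f ∈ holderClass β L, (1 < β → ∀ t ∈ Icc (0 : ℝ) 1, |f t| ≤ B) →
      ∀ x ∈ Icc (0 : ℝ) 1, ∀ y ∈ Icc (0 : ℝ) 1, |f x - f y| ≤ M * |x - y| ^ min β 1 := by
  rcases le_or_gt β 1 with h1 | h1
  · refine ⟨L, fun f hf _ x hx y hy => ?_⟩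
    have := hf.2 x hx y hy
    rw [strictFloor_eq_zero h1] at this
    simpa [min_eq_left h1] using this
  · obtain ⟨M, hM⟩ := exists_abs_iteratedDerivWithin_one_le (B := B) h1 hL
    refine ⟨|M|, fun f hf hB x hx y hy => ?_⟩
    rw [min_eq_right h1.le, Real.rpow_one]
    refine Convex.norm_image_sub_le_of_norm_hasDerivWithin_le (s := Icc (0 : ℝ) 1)
      (f' := iteratedDerivWithin 1 f (Icc 0 1)) (fun t ht => ?_)
      (fun t ht => (hM f hf (hB h1) t ht).trans (le_abs_self M)) (convex_Icc 0 1) hy hx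
    simpa using hasDerivWithinAt_of_mem_holderClass hf (strictFloor_pos h1) ht

/-! ### Weighted least squares -/

section WeightedLeastSquares

open scoped Matrix

variable {ι κ : Type*} [Fintype ι] [Fintype κ]

/-- The matrix `∑ i, k i • U i (U i)ᵀ` of the normal equations for regressors `U i` and
weights `k i`. -/
def gramMatrix (U : ι → κ → ℝ) (k : ι → ℝ) : Matrix κ κ ℝ :=
  ∑ i, k i • Matrix.vecMulVec (U i) (U i)

theorem dotProduct_gramMatrix_mulVec (U : ι → κ → ℝ) (k : ι → ℝ) (η θ : κ → ℝ) :
    η ⬝ᵥ (gramMatrix U k *ᵥ θ) = ∑ i, (η ⬝ᵥ U i) * (θ ⬝ᵥ U i) * k i := by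
  rw [gramMatrix, Matrix.sum_mulVec, dotProduct_sum]
  refine Finset.sum_congr rfl fun i _ => ?_
  rw [Matrix.smul_mulVec, Matrix.vecMulVec_mulVec, dotProduct_smul, dotProduct_smul,
    dotProduct_comm (U i) θ]
  simp
  ring

/-- The identity behind the normal equations: the criterion differs from its value at a solution
of the normal equations by a quadratic form. -/
theorem sum_sq_sub_eq_of_normal_equations {U : ι → κ → ℝ} {k y : ι → ℝ} {θ : κ → ℝ}
    (hθ : gramMatrix U k *ᵥ θ = ∑ i, (k i * y i) • U i) (θ' : κ → ℝ) :
    ∑ i, (y i - θ' ⬝ᵥ U i) ^ 2 * k i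
      = ∑ i, (y i - θ ⬝ᵥ U i) ^ 2 * k i + ∑ i, ((θ' - θ) ⬝ᵥ U i) ^ 2 * k i := by
  have h1 := dotProduct_gramMatrix_mulVec U k (θ' - θ) θ
  rw [hθ, dotProduct_sum] at h1
  simp only [dotProduct_smul, smul_eq_mul] at h1
  have h2 : ∑ i, (y i - θ' ⬝ᵥ U i) ^ 2 * k i
      - (∑ i, (y i - θ ⬝ᵥ U i) ^ 2 * k i + ∑ i, ((θ' - θ) ⬝ᵥ U i) ^ 2 * k i)
      = 2 * (∑ i, ((θ' - θ) ⬝ᵥ U i) * (θ ⬝ᵥ U i) * k i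
          - ∑ i, k i * y i * ((θ' - θ) ⬝ᵥ U i)) := by
    rw [← Finset.sum_add_distrib, ← Finset.sum_sub_distrib, ← Finset.sum_sub_distrib,
      Finset.mul_sum]
    refine Finset.sum_congr rfl fun i _ => ?_
    rw [sub_dotProduct]
    ring
  rw [h1, sub_self, mul_zero] at h2
  linarith

variable [DecidableEq κ]

/-- The coefficient of the `i`-th response in the linear functional `e ⬝ᵥ θ` of the weighted least
squares solution `θ`. -/
noncomputable def leastSquaresWeight (U : ι → κ → ℝ) (k : ι → ℝ) (e : κ → ℝ) (i : ι) : ℝ :=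
  (((gramMatrix U k)⁻¹ *ᵥ e) ⬝ᵥ U i) * k i

variable {U : ι → κ → ℝ} {k : ι → ℝ} {c : ℝ}

theorem isUnit_gramMatrix (hc : 0 < c)
    (h : ∀ v : κ → ℝ, c * (v ⬝ᵥ v) ≤ ∑ i, (v ⬝ᵥ U i) ^ 2 * k i) :
    IsUnit (gramMatrix U k) := by
  rw [← Matrix.mulVec_injective_iff_isUnit]
  intro v w hvw
  have h1 : gramMatrix U k *ᵥ (v - w) = 0 := by rw [Matrix.mulVec_sub]; exact sub_eq_zero.2 hvw
  have h2 := dotProduct_gramMatrix_mulVec U k (v - w) (v - w)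
  rw [h1, dotProduct_zero] at h2
  have h3 := h (v - w)
  simp only [sq] at h3
  rw [← h2] at h3
  have h4 : (v - w) ⬝ᵥ (v - w) = 0 := le_antisymm (by nlinarith)
    (Finset.sum_nonneg fun i _ => mul_self_nonneg _)
  exact sub_eq_zero.1 (dotProduct_self_eq_zero.1 h4)

theorem gramMatrix_mulVec_inv_mulVec (hc : 0 < c)
    (h : ∀ v : κ → ℝ, c * (v ⬝ᵥ v) ≤ ∑ i, (v ⬝ᵥ U i) ^ 2 * k i) (e : κ → ℝ) :
    gramMatrix U k *ᵥ ((gramMatrix U k)⁻¹ *ᵥ e) = e := by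
  have hdet := (Matrix.isUnit_iff_isUnit_det _).1 (isUnit_gramMatrix hc h)
  rw [Matrix.mulVec_mulVec, Matrix.mul_nonsing_inv _ hdet, Matrix.one_mulVec]

/-- A coercive weighted least squares criterion has exactly one minimizer, and linear functionals
of the minimizer are linear in the responses, with coefficients `leastSquaresWeight`. -/
theorem exists_unique_leastSquares (hc : 0 < c)
    (h : ∀ v : κ → ℝ, c * (v ⬝ᵥ v) ≤ ∑ i, (v ⬝ᵥ U i) ^ 2 * k i) (y : ι → ℝ) :
    ∃ θ : κ → ℝ,
      (∀ θ', (∀ θ'', ∑ i, (y i - θ' ⬝ᵥ U i) ^ 2 * k i ≤ ∑ i, (y i - θ'' ⬝ᵥ U i) ^ 2 * k i) ↔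
        θ' = θ) ∧
      ∀ e, e ⬝ᵥ θ = ∑ i, leastSquaresWeight U k e i * y i := by
  refine ⟨(gramMatrix U k)⁻¹ *ᵥ ∑ i, (k i * y i) • U i, fun θ' => ?_, fun e => ?_⟩
  all_goals
    have hθ := gramMatrix_mulVec_inv_mulVec hc h (∑ i, (k i * y i) • U i)
    set θ := (gramMatrix U k)⁻¹ *ᵥ ∑ i, (k i * y i) • U i
  · have hcrit := sum_sq_sub_eq_of_normal_equations hθ
    constructor
    · intro hmin
      have h1 := hmin θ
      rw [hcrit θ'] at h1
      have h2 := h (θ' - θ)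
      have h3 : (θ' - θ) ⬝ᵥ (θ' - θ) = 0 := le_antisymm (by nlinarith)
        (Finset.sum_nonneg fun i _ => mul_self_nonneg _)
      exact sub_eq_zero.1 (dotProduct_self_eq_zero.1 h3)
    · rintro rfl θ''
      rw [hcrit θ'']
      have h2 := h (θ'' - θ)
      have h3 : 0 ≤ (θ'' - θ) ⬝ᵥ (θ'' - θ) := Finset.sum_nonneg fun i _ => mul_self_nonneg _
      nlinarith
  · set v := (gramMatrix U k)⁻¹ *ᵥ e with hv
    have h1 := dotProduct_gramMatrix_mulVec U k v θ
    have h2 := dotProduct_gramMatrix_mulVec U k θ v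
    rw [hv, gramMatrix_mulVec_inv_mulVec hc h e, ← hv] at h2
    rw [hθ, dotProduct_sum] at h1
    rw [dotProduct_comm, h2, Finset.sum_congr rfl fun i _ =>
      show (θ ⬝ᵥ U i) * (v ⬝ᵥ U i) * k i = (v ⬝ᵥ U i) * (θ ⬝ᵥ U i) * k i by ring, ← h1]
    refine Finset.sum_congr rfl fun i _ => ?_
    rw [leastSquaresWeight, ← hv, dotProduct_smul, smul_eq_mul]
    ring

/-- The weights reproduce the regressors. -/
theorem sum_leastSquaresWeight_mul (hc : 0 < c)
    (h : ∀ v : κ → ℝ, c * (v ⬝ᵥ v) ≤ ∑ i, (v ⬝ᵥ U i) ^ 2 * k i) (e θ : κ → ℝ) :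
    ∑ i, leastSquaresWeight U k e i * (θ ⬝ᵥ U i) = e ⬝ᵥ θ := by
  have h1 := dotProduct_gramMatrix_mulVec U k θ ((gramMatrix U k)⁻¹ *ᵥ e)
  rw [gramMatrix_mulVec_inv_mulVec hc h e] at h1
  rw [dotProduct_comm e, h1]
  refine Finset.sum_congr rfl fun i _ => ?_
  rw [leastSquaresWeight]
  ring

/-- With `v` the solution of `gramMatrix U k *ᵥ v = e`, the sum of the squared weights is at most
`kmax * (e ⬝ᵥ v)`, and coercivity bounds `e ⬝ᵥ v` by `(e ⬝ᵥ e) / c`. -/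
theorem sum_leastSquaresWeight_sq_le (hc : 0 < c)
    (h : ∀ v : κ → ℝ, c * (v ⬝ᵥ v) ≤ ∑ i, (v ⬝ᵥ U i) ^ 2 * k i) {kmax : ℝ} (hk : ∀ i, 0 ≤ k i)
    (hkmax : ∀ i, k i ≤ kmax) (hmax : 0 ≤ kmax) (e : κ → ℝ) :
    ∑ i, leastSquaresWeight U k e i ^ 2 ≤ kmax * (e ⬝ᵥ e) / c := by
  set v := (gramMatrix U k)⁻¹ *ᵥ e with hv
  have h1 := dotProduct_gramMatrix_mulVec U k v v
  have h2 := h v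
  simp only [sq] at h2
  rw [← h1, hv, gramMatrix_mulVec_inv_mulVec hc h e, ← hv] at h2
  rw [hv, gramMatrix_mulVec_inv_mulVec hc h e, ← hv] at h1
  have h3 : ∑ i, leastSquaresWeight U k e i ^ 2 ≤ kmax * (v ⬝ᵥ e) := by
    rw [h1, Finset.mul_sum]
    refine Finset.sum_le_sum fun i _ => ?_
    rw [leastSquaresWeight, ← hv]
    have := mul_nonneg (mul_nonneg (mul_self_nonneg (v ⬝ᵥ U i)) (hk i)) (sub_nonneg.2 (hkmax i))
    nlinarith
  refine h3.trans ?_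
  rw [mul_div_assoc]
  refine mul_le_mul_of_nonneg_left ?_ hmax
  rw [le_div_iff₀ hc]
  have h4 : 0 ≤ (c • v - e) ⬝ᵥ (c • v - e) := Finset.sum_nonneg fun i _ => mul_self_nonneg _
  simp only [sub_dotProduct, dotProduct_sub, smul_dotProduct, dotProduct_smul, smul_eq_mul,
    dotProduct_comm e v] at h4
  nlinarith

theorem leastSquaresWeight_eq_zero {i : ι} (hi : k i = 0) (e : κ → ℝ) :
    leastSquaresWeight U k e i = 0 := by
  rw [leastSquaresWeight, hi, mul_zero]

theorem measurable_leastSquaresWeight {α : Type*} [MeasurableSpace α] {U : α → ι → κ → ℝ}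
    {k : α → ι → ℝ} (hU : ∀ i a, Measurable fun t => U t i a) (hk : ∀ i, Measurable fun t => k t i)
    (e : κ → ℝ) (i : ι) : Measurable fun t => leastSquaresWeight (U t) (k t) e i := by
  have hG : ∀ a b, Measurable fun t => gramMatrix (U t) (k t) a b := by
    intro a b
    simp only [gramMatrix, Matrix.sum_apply, Matrix.smul_apply, Matrix.vecMulVec_apply, smul_eq_mul]
    exact Finset.measurable_fun_sum _ fun i _ => (hk i).mul ((hU i a).mul (hU i b))
  have hdet : ∀ M : α → Matrix κ κ ℝ, (∀ a b, Measurable fun t => M t a b) →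
      Measurable fun t => (M t).det := by
    intro M hM
    simp only [Matrix.det_apply']
    exact Finset.measurable_fun_sum _ fun σ _ =>
      (Finset.measurable_fun_prod _ fun a _ => hM _ _).const_mul _
  have hinv : ∀ a b, Measurable fun t => (gramMatrix (U t) (k t))⁻¹ a b := by
    intro a b
    simp only [Matrix.inv_def, Matrix.smul_apply, smul_eq_mul, Ring.inverse_eq_inv,
      Matrix.adjugate_apply]
    refine (hdet _ hG).inv.mul (hdet _ fun a' b' => ?_)
    by_cases hab : a' = b
    · subst hab
      simp
    · simpa [Matrix.updateRow_ne hab] using hG a' b'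
  simp only [leastSquaresWeight, dotProduct, Matrix.mulVec]
  exact (Finset.measurable_fun_sum _ fun a _ =>
    (Finset.measurable_fun_sum _ fun b _ => (hinv a b).mul_const _).mul (hU i a)).mul (hk i)

end WeightedLeastSquares

/-! ### Coercivity of the local criterion -/

theorem pseudoDesign_mem_Icc {n : ℕ} (i : Fin n) : pseudoDesign n i ∈ Icc (0 : ℝ) 1 := by
  have hi : ((i : ℕ) : ℝ) + 1 ≤ n := by exact_mod_cast i.2
  rw [pseudoDesign]
  exact ⟨by positivity, by rw [div_le_one (by positivity)]; linarith⟩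

/-- The local least squares criterion is coercive as soon as the window of width `h` contains
enough design points: the points of the window split into groups of `l + 1` equally spaced points
whose spacing is comparable to `h`. -/
theorem exists_pos_mul_le_sum_sq_mul_kernel (l : ℕ) {K : ℝ → ℝ} (hK : IsLocalPolyKernel K) :
    ∃ c > 0, ∃ Δ > 0, ∀ (n : ℕ) (h : ℝ), 0 < h → Δ * h ≤ 1 / 2 →
      (l : ℝ) + 1 ≤ Δ * h * ((n : ℝ) + 1) → ∀ t ∈ Icc (0 : ℝ) 1, ∀ v : Fin (l + 1) → ℝ,
        c * (n * h) * (v ⬝ᵥ v) ≤ ∑ i : Fin n, (v ⬝ᵥ monomialVec l ((pseudoDesign n i - t) / h)) ^ 2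
          * K ((pseudoDesign n i - t) / h) := by
  obtain ⟨Kmin, hKmin, Δ, hΔ, hlow⟩ := hK.lower
  have hl : (0 : ℝ) < (l : ℝ) + 1 := by positivity
  obtain ⟨c, hc, H⟩ := exists_pos_le_sum_sq_dotProduct_monomialVec l Δ
    (w₀ := Δ / (2 * ((l : ℝ) + 1))) (by positivity)
  refine ⟨Kmin * c * (Δ / (2 * ((l : ℝ) + 1))), by positivity, Δ, hΔ,
    fun n h hh hh2 hnh t ht v => ?_⟩
  have hn1 : (0 : ℝ) < (n : ℝ) + 1 := by positivity
  -- `m` groups of `l + 1` points, each group with spacing `m / (n + 1)`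
  set q : ℝ := Δ * h * ((n : ℝ) + 1) / ((l : ℝ) + 1) with hq
  have hq1 : 1 ≤ q := by rwa [hq, le_div_iff₀ hl, one_mul]
  set m : ℕ := ⌊q⌋₊ with hm
  have hm1 : 1 ≤ m := Nat.le_floor (by exact_mod_cast hq1)
  have hmq : (m : ℝ) ≤ q := Nat.floor_le (by linarith)
  have hqm : q ≤ 2 * m := by
    have := Nat.lt_floor_add_one q
    have h1 : (1 : ℝ) ≤ m := by exact_mod_cast hm1
    linarith
  have hmN : ((l : ℝ) + 1) * m ≤ Δ * h * ((n : ℝ) + 1) := by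
    rw [hq, le_div_iff₀ hl] at hmq
    linarith
  have hNn : (l + 1) * m ≤ n := by
    have h1 : (((l + 1) * m : ℕ) : ℝ) * 2 ≤ n + 1 := by
      push_cast
      nlinarith
    have h2 : (l + 1) * m * 2 ≤ n + 1 := by exact_mod_cast h1
    have h3 : 1 ≤ (l + 1) * m := Nat.one_le_iff_ne_zero.2 (by positivity)
    omega
  -- the first point of the first group; all groups lie within `Δ * h` of `t`
  set i₀ : ℕ := min ⌊t * n⌋₊ (n - (l + 1) * m) with hi₀
  have hi₀n : i₀ + (l + 1) * m ≤ n := by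
    have : i₀ ≤ n - (l + 1) * m := min_le_right _ _
    omega
  have hNreal : ((n - (l + 1) * m : ℕ) : ℝ) = n - ((l : ℝ) + 1) * m := by
    rw [Nat.cast_sub hNn]
    push_cast
    ring
  have hup : (i₀ : ℝ) ≤ t * n :=
    (Nat.cast_le.2 (min_le_left _ _)).trans (Nat.floor_le (mul_nonneg ht.1 (Nat.cast_nonneg n)))
  have hdown : t * ((n : ℝ) + 1) - ((l : ℝ) + 1) * m ≤ i₀ + 1 := by
    rcases min_choice ⌊t * n⌋₊ (n - (l + 1) * m) with h1 | h1
    · rw [hi₀, h1]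
      have h2 := Nat.lt_floor_add_one (t * n)
      have h3 : (1 : ℝ) ≤ m := by exact_mod_cast hm1
      have h4 : (0 : ℝ) ≤ l := Nat.cast_nonneg l
      nlinarith [ht.2]
    · rw [hi₀, h1, hNreal]
      nlinarith [ht.2]
  let e : Fin (l + 1) × Fin m → Fin n := fun p =>
    ⟨i₀ + (finProdFinEquiv p : ℕ), by have := (finProdFinEquiv p).2; omega⟩
  have he : Function.Injective e := by
    intro p p' hpp
    have h1 : i₀ + (finProdFinEquiv p : ℕ) = i₀ + (finProdFinEquiv p' : ℕ) := congrArg Fin.val hpp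
    exact finProdFinEquiv.injective (Fin.ext (by omega))
  set w : ℝ := m / ((n + 1) * h) with hw
  set τ : Fin m → ℝ := fun b => (((i₀ : ℝ) + b + 1) / (n + 1) - t) / h with hτ
  have hpt : ∀ (a : Fin (l + 1)) (b : Fin m), (pseudoDesign n (e (a, b)) - t) / h = τ b + a * w := by
    intro a b
    simp only [pseudoDesign, e, hτ, hw, finProdFinEquiv_apply_val]
    push_cast
    field_simp
    ring
  have hclose : ∀ (a : Fin (l + 1)) (b : Fin m), |τ b + a * w| ≤ Δ := by
    intro a b
    have hlt : (finProdFinEquiv (a, b) : ℕ) + 1 ≤ (l + 1) * m := (finProdFinEquiv (a, b)).2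
    have hlt' : ((finProdFinEquiv (a, b) : ℕ) : ℝ) + 1 ≤ ((l : ℝ) + 1) * m := by exact_mod_cast hlt
    have h0 : (0 : ℝ) ≤ ((finProdFinEquiv (a, b) : ℕ) : ℝ) := Nat.cast_nonneg _
    rw [← hpt, abs_div, abs_of_pos hh, div_le_iff₀ hh, abs_le]
    simp only [pseudoDesign, e]
    push_cast
    have h1 : ((i₀ : ℝ) + ((finProdFinEquiv (a, b) : ℕ) : ℝ) + 1) / ((n : ℝ) + 1) - t
        = ((i₀ : ℝ) + ((finProdFinEquiv (a, b) : ℕ) : ℝ) + 1 - t * (n + 1)) / ((n : ℝ) + 1) := by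
      field_simp
    rw [h1, le_div_iff₀ hn1, div_le_iff₀ hn1]
    constructor
    · linarith
    · nlinarith [ht.1]
  have hwlow : Δ / (2 * ((l : ℝ) + 1)) ≤ w := by
    rw [hw, div_le_div_iff₀ (by positivity) (by positivity)]
    rw [hq, div_le_iff₀ hl] at hqm
    linarith
  have hwup : w ≤ Δ := by
    rw [hw, div_le_iff₀ (by positivity)]
    have h3 : (0 : ℝ) ≤ l * m := by positivity
    linarith
  have hterm : ∀ i : Fin n, 0 ≤ (v ⬝ᵥ monomialVec l ((pseudoDesign n i - t) / h)) ^ 2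
      * K ((pseudoDesign n i - t) / h) := fun i => mul_nonneg (sq_nonneg _) (hK.nonneg _)
  calc Kmin * c * (Δ / (2 * ((l : ℝ) + 1))) * (n * h) * (v ⬝ᵥ v)
      ≤ ∑ _b : Fin m, Kmin * (c * (v ⬝ᵥ v)) := by
        rw [Finset.sum_const, Finset.card_univ, Fintype.card_fin, nsmul_eq_mul]
        have h1 : Δ / (2 * ((l : ℝ) + 1)) * (n * h) ≤ m := by
          rw [hq, div_le_iff₀ hl] at hqm
          rw [div_mul_eq_mul_div, div_le_iff₀ (by positivity)]
          nlinarith [mul_pos hΔ hh]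
        have h2 : 0 ≤ v ⬝ᵥ v := Finset.sum_nonneg fun i _ => mul_self_nonneg _
        have h3 := mul_le_mul_of_nonneg_right h1 (mul_nonneg (mul_nonneg hKmin.le hc.le) h2)
        linarith
    _ ≤ ∑ b : Fin m, ∑ a : Fin (l + 1), (v ⬝ᵥ monomialVec l (τ b + a * w)) ^ 2
          * K (τ b + a * w) := by
        refine Finset.sum_le_sum fun b _ => ?_
        have h1 := H (τ b) w (by simpa using hclose 0 b) hwlow hwup v
        refine (mul_le_mul_of_nonneg_left h1 hKmin.le).trans ?_
        rw [Finset.mul_sum]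
        refine Finset.sum_le_sum fun a _ => ?_
        rw [mul_comm]
        exact mul_le_mul_of_nonneg_left (hlow _ (hclose a b)) (sq_nonneg _)
    _ = ∑ p : Fin (l + 1) × Fin m, (v ⬝ᵥ monomialVec l ((pseudoDesign n (e p) - t) / h)) ^ 2
          * K ((pseudoDesign n (e p) - t) / h) := by
        rw [Finset.sum_comm, Fintype.sum_prod_type]
        simp only [hpt]
    _ ≤ _ := by
        rw [← Finset.sum_image (f := fun i : Fin n =>
          (v ⬝ᵥ monomialVec l ((pseudoDesign n i - t) / h)) ^ 2
            * K ((pseudoDesign n i - t) / h)) (fun _ _ _ _ h => he h)]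
        exact Finset.sum_le_univ_sum_of_nonneg hterm

/-! ### Order statistics of a uniform sample -/

theorem measurableSet_sort_eq {Ω : Type*} [MeasurableSpace Ω] {n : ℕ} {x : Fin n → Ω → ℝ}
    (hx : ∀ i, Measurable (x i)) (π : Equiv.Perm (Fin n)) :
    MeasurableSet {ω | Tuple.sort (fun i => x i ω) = π} := by
  have h : {ω | Tuple.sort (fun i => x i ω) = π}
      = {ω | ∀ i j, i ≤ j → x (π i) ω ≤ x (π j) ω} ∩
        {ω | ∀ i j, i < j → (x (π i) ω = x (π j) ω → π i < π j)} := by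
    ext ω
    simp only [mem_ofPred_eq, mem_inter_iff, eq_comm (b := π), Tuple.eq_sort_iff]
    exact and_congr ⟨fun h i j hij => h hij, fun h i j hij => h i j hij⟩ Iff.rfl
  rw [h]
  simp only [ofPred_forall]
  refine MeasurableSet.inter ?_ ?_
  · exact MeasurableSet.iInter fun i => MeasurableSet.iInter fun j => MeasurableSet.iInter fun _ =>
      measurableSet_le (hx _) (hx _)
  · refine MeasurableSet.iInter fun i => MeasurableSet.iInter fun j => MeasurableSet.iInter fun _ =>
      ?_
    by_cases hij : π i < π j
    · simp [hij]
    · simp only [hij, imp_false]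
      exact (measurableSet_eq_fun (hx _) (hx _)).compl

theorem measurable_apply_sort {Ω : Type*} [MeasurableSpace Ω] {n : ℕ} {x : Fin n → Ω → ℝ}
    (hx : ∀ i, Measurable (x i)) {g : Equiv.Perm (Fin n) → Ω → ℝ} (hg : ∀ π, Measurable (g π)) :
    Measurable fun ω => g (Tuple.sort fun i => x i ω) ω := by
  have h : (fun ω => g (Tuple.sort fun i => x i ω) ω)
      = fun ω => ∑ π, {ω | Tuple.sort (fun i => x i ω) = π}.indicator (g π) ω := by
    ext ω
    rw [Finset.sum_eq_single (Tuple.sort fun i => x i ω)]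
    · simp
    · intro π _ hπ
      simp [hπ.symm]
    · simp
  rw [h]
  exact Finset.measurable_fun_sum _ fun π _ => (hg π).indicator (measurableSet_sort_eq hx π)

theorem card_filter_lt_le_of_le_sort {n : ℕ} {x : Fin n → ℝ} {i : Fin n} {r : ℝ}
    (h : r ≤ x (Tuple.sort x i)) : (Finset.univ.filter fun j => x j < r).card ≤ i := by
  have hsub : (Finset.univ.filter fun j => x j < r) ⊆ (Finset.Iio i).image (Tuple.sort x) := by
    intro j hj
    rw [Finset.mem_filter] at hj
    refine Finset.mem_image.2 ⟨(Tuple.sort x).symm j, Finset.mem_Iio.2 ?_, by simp⟩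
    by_contra hle
    have h1 : x (Tuple.sort x i) ≤ x (Tuple.sort x ((Tuple.sort x).symm j)) :=
      Tuple.monotone_sort x (not_lt.1 hle)
    rw [Equiv.apply_symm_apply] at h1
    linarith [hj.2]
  simpa using (Finset.card_le_card hsub).trans Finset.card_image_le

theorem le_card_filter_le_of_sort_le {n : ℕ} {x : Fin n → ℝ} {i : Fin n} {r : ℝ}
    (h : x (Tuple.sort x i) ≤ r) : (i : ℕ) + 1 ≤ (Finset.univ.filter fun j => x j ≤ r).card := by
  have hsub : (Finset.Iic i).image (Tuple.sort x) ⊆ Finset.univ.filter fun j => x j ≤ r := by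
    intro j hj
    obtain ⟨k, hk, rfl⟩ := Finset.mem_image.1 hj
    exact Finset.mem_filter.2 ⟨Finset.mem_univ _,
      (Tuple.monotone_sort x (Finset.mem_Iic.1 hk)).trans h⟩
  have h1 := Finset.card_le_card hsub
  rw [Finset.card_image_of_injective _ (Tuple.sort x).injective] at h1
  simpa using h1

/-- A sample of size `n` from the uniform distribution on `[0, 1]`, in a version that is measurable
and takes its values in `[0, 1]` everywhere. -/
structure IsUniformSample {Ω : Type*} [MeasurableSpace Ω] (P : Measure Ω) {n : ℕ}
    (x : Fin n → Ω → ℝ) : Prop where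
  measurable : ∀ i, Measurable (x i)
  mem : ∀ i ω, x i ω ∈ Icc (0 : ℝ) 1
  hasLaw : ∀ i, HasLaw (x i) (volume.restrict (Icc (0 : ℝ) 1)) P
  indep : iIndepFun x P

theorem IsUniformSample.measurable_orderStatistic {Ω : Type*} [MeasurableSpace Ω] {P : Measure Ω}
    {n : ℕ} {x : Fin n → Ω → ℝ} (hx : IsUniformSample P x) (i : Fin n) :
    Measurable fun ω => x (Tuple.sort (fun j => x j ω) i) ω :=
  measurable_apply_sort hx.measurable (g := fun π ω => x (π i) ω) fun π => hx.measurable (π i)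

section Design

variable {Ω : Type*} [MeasurableSpace Ω] {P : Measure Ω} [IsProbabilityMeasure P] {n : ℕ}
  {x : Fin n → Ω → ℝ}

theorem IsUniformSample.measureReal_le_exp (hx : IsUniformSample P x) (hn : 0 < n) {g : ℝ → ℝ}
    (hg : Measurable g) {a : ℝ} (ha : ∀ u, g u ∈ Icc a (a + 1)) {s : ℝ} (hs : 0 ≤ s) :
    P.real {ω | n * s ≤ ∑ j, (g (x j ω) - ∫ u in Icc (0 : ℝ) 1, g u)}
      ≤ Real.exp (-2 * n * s ^ 2) := by
  have hn' : (0 : ℝ) < n := by exact_mod_cast hn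
  have hmean : ∀ j, ∫ ω, g (x j ω) ∂P = ∫ u in Icc (0 : ℝ) 1, g u := fun j =>
    (hx.hasLaw j).integral_comp hg.aestronglyMeasurable
  have hind : iIndepFun (fun j ω => g (x j ω) - ∫ u in Icc (0 : ℝ) 1, g u) P :=
    hx.indep.comp (fun _ u => g u - ∫ u in Icc (0 : ℝ) 1, g u) fun _ => hg.sub_const _
  have hsub : ∀ j ∈ (Finset.univ : Finset (Fin n)), HasSubgaussianMGF
      (fun ω => g (x j ω) - ∫ u in Icc (0 : ℝ) 1, g u) ((‖a + 1 - a‖₊ / 2) ^ 2) P := by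
    intro j _
    rw [← hmean j]
    exact hasSubgaussianMGF_of_mem_Icc (hg.comp (hx.measurable j)).aemeasurable
      (ae_of_all _ fun ω => ha _)
  refine (HasSubgaussianMGF.measure_sum_ge_le_of_iIndepFun hind hsub
    (mul_nonneg hn'.le hs)).trans (le_of_eq ?_)
  congr 1
  rw [Finset.sum_const, Finset.card_univ, Fintype.card_fin, nsmul_eq_mul]
  simp
  field_simp

theorem integral_indicator_Iio_one {r : ℝ} (hr : r ∈ Icc (0 : ℝ) 1) :
    ∫ u in Icc (0 : ℝ) 1, (Iio r).indicator (fun _ => (1 : ℝ)) u = r := by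
  rw [integral_indicator measurableSet_Iio, Measure.restrict_restrict measurableSet_Iio,
    setIntegral_const, smul_eq_mul, mul_one]
  have : Iio r ∩ Icc 0 1 = Ico 0 r := by
    ext u
    simp only [mem_inter_iff, mem_Iio, mem_Icc, mem_Ico]
    exact ⟨fun h => ⟨h.2.1, h.1⟩, fun h => ⟨h.2, h.1, h.2.le.trans hr.2⟩⟩
  rw [this, Real.volume_real_Ico_of_le hr.1, sub_zero]

theorem integral_indicator_Iic_one {r : ℝ} (hr : r ∈ Icc (0 : ℝ) 1) :
    ∫ u in Icc (0 : ℝ) 1, (Iic r).indicator (fun _ => (1 : ℝ)) u = r := by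
  rw [integral_indicator measurableSet_Iic, Measure.restrict_restrict measurableSet_Iic,
    setIntegral_const, smul_eq_mul, mul_one]
  have : Iic r ∩ Icc 0 1 = Icc 0 r := by
    ext u
    simp only [mem_inter_iff, mem_Iic, mem_Icc]
    exact ⟨fun h => ⟨h.2.1, h.1⟩, fun h => ⟨h.2, h.1, h.2.trans hr.2⟩⟩
  rw [this, Real.volume_real_Icc_of_le hr.1, sub_zero]

theorem sum_indicator_one_eq_card (y : Fin n → ℝ) (p : ℝ → Prop) [DecidablePred p] :
    ∑ j, {u | p u}.indicator (fun _ => (1 : ℝ)) (y j)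
      = ((Finset.univ.filter fun j => p (y j)).card : ℝ) := by
  simp [Set.indicator_apply]

/-- An order statistic deviates by `s` from `i / (n + 1)` only if an empirical frequency deviates
by `s` from its mean, so Hoeffding's inequality applies. -/
theorem IsUniformSample.measureReal_orderStatistic_le (hx : IsUniformSample P x) (i : Fin n) {s : ℝ}
    (hs : 0 ≤ s) :
    P.real {ω | s ≤ |x (Tuple.sort (fun j => x j ω) i) ω - pseudoDesign n i|}
      ≤ 2 * Real.exp (-2 * n * s ^ 2) := by
  have hn : 0 < n := i.pos
  have hn' : (0 : ℝ) < n := by exact_mod_cast hn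
  have hi : ((i : ℕ) : ℝ) + 1 ≤ n := by exact_mod_cast i.2
  have hi0 : (0 : ℝ) ≤ ((i : ℕ) : ℝ) := Nat.cast_nonneg _
  set δ := pseudoDesign n i with hδ
  have hδ1 : δ * (n + 1) = (i : ℕ) + 1 := by rw [hδ, pseudoDesign]; field_simp
  obtain ⟨hδ0, hδ2⟩ := pseudoDesign_mem_Icc i
  have hup : P.real {ω | δ + s ≤ x (Tuple.sort (fun j => x j ω) i) ω}
      ≤ Real.exp (-2 * n * s ^ 2) := by
    rcases lt_or_ge 1 (δ + s) with h1 | h1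
    · have : {ω | δ + s ≤ x (Tuple.sort (fun j => x j ω) i) ω} = ∅ := by
        ext ω
        simp only [mem_ofPred_eq, mem_empty_iff_false, iff_false, not_le]
        exact (hx.mem _ ω).2.trans_lt h1
      rw [this, measureReal_empty]
      positivity
    · refine le_trans (measureReal_mono ?_) (hx.measureReal_le_exp hn (a := -1)
        (g := fun u => -(Iio (δ + s)).indicator (fun _ => (1 : ℝ)) u)
        (measurable_const.indicator measurableSet_Iio).neg (fun u => ?_) hs)
      · intro ω hω
        have h2 := card_filter_lt_le_of_le_sort (x := fun j => x j ω) hω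
        have h3 := sum_indicator_one_eq_card (fun j => x j ω) (fun u => u < δ + s)
        have h4 : ((Finset.univ.filter fun j => x j ω < δ + s).card : ℝ) ≤ (i : ℕ) := by
          exact_mod_cast h2
        rw [mem_ofPred_eq, integral_neg, integral_indicator_Iio_one ⟨by linarith, h1⟩,
          Finset.sum_sub_distrib, Finset.sum_neg_distrib, Finset.sum_const, Finset.card_univ,
          Fintype.card_fin, nsmul_eq_mul]
        change _ ≤ -(∑ j, {u | u < δ + s}.indicator (fun _ => (1 : ℝ)) (x j ω)) - _
        rw [h3]
        nlinarith
      · by_cases hu : u ∈ Iio (δ + s) <;> simp [hu]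
  have hdown : P.real {ω | x (Tuple.sort (fun j => x j ω) i) ω ≤ δ - s}
      ≤ Real.exp (-2 * n * s ^ 2) := by
    rcases lt_or_ge (δ - s) 0 with h1 | h1
    · have : {ω | x (Tuple.sort (fun j => x j ω) i) ω ≤ δ - s} = ∅ := by
        ext ω
        simp only [mem_ofPred_eq, mem_empty_iff_false, iff_false, not_le]
        exact h1.trans_le (hx.mem _ ω).1
      rw [this, measureReal_empty]
      positivity
    · refine le_trans (measureReal_mono ?_) (hx.measureReal_le_exp hn (a := 0)
        (g := fun u => (Iic (δ - s)).indicator (fun _ => (1 : ℝ)) u)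
        (measurable_const.indicator measurableSet_Iic) (fun u => ?_) hs)
      · intro ω hω
        have h2 := le_card_filter_le_of_sort_le (x := fun j => x j ω) hω
        have h3 := sum_indicator_one_eq_card (fun j => x j ω) (fun u => u ≤ δ - s)
        have h4 : ((i : ℕ) : ℝ) + 1 ≤ ((Finset.univ.filter fun j => x j ω ≤ δ - s).card : ℝ) := by
          exact_mod_cast h2
        rw [mem_ofPred_eq, integral_indicator_Iic_one ⟨h1, by linarith⟩,
          Finset.sum_sub_distrib, Finset.sum_const, Finset.card_univ,
          Fintype.card_fin, nsmul_eq_mul]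
        change _ ≤ (∑ j, {u | u ≤ δ - s}.indicator (fun _ => (1 : ℝ)) (x j ω)) - _
        rw [h3]
        nlinarith
      · by_cases hu : u ∈ Iic (δ - s) <;> simp [hu]
  refine (measureReal_mono (?_ : _ ⊆ {ω | δ + s ≤ x (Tuple.sort (fun j => x j ω) i) ω} ∪
    {ω | x (Tuple.sort (fun j => x j ω) i) ω ≤ δ - s})).trans ((measureReal_union_le _ _).trans ?_)
  · intro ω hω
    rcases le_abs.1 (show s ≤ |x (Tuple.sort (fun j => x j ω) i) ω - δ| from hω) with h | h
    · exact Or.inl (show δ + s ≤ _ by linarith)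
    · exact Or.inr (show _ ≤ δ - s by linarith)
  · linarith

theorem sq_le_sum_odd_indicator {y : ℝ} (hy : 0 ≤ y) {m : ℕ} (hm : y ≤ m) :
    y ^ 2 ≤ ∑ k ∈ Finset.range (m + 1), (2 * (k : ℝ) + 1) * (if (k : ℝ) ≤ y then 1 else 0) := by
  have hodd : ∀ q : ℕ, ∑ k ∈ Finset.range q, (2 * (k : ℝ) + 1) = (q : ℝ) ^ 2 := by
    intro q
    induction q with
    | zero => simp
    | succ q ih => rw [Finset.sum_range_succ, ih]; push_cast; ring
  have h1 : ⌊y⌋₊ ≤ m := Nat.floor_le_of_le hm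
  calc y ^ 2 ≤ ((⌊y⌋₊ + 1 : ℕ) : ℝ) ^ 2 := by
        have := Nat.lt_floor_add_one y
        push_cast
        gcongr
    _ = ∑ k ∈ Finset.range (⌊y⌋₊ + 1), (2 * (k : ℝ) + 1) * (if (k : ℝ) ≤ y then 1 else 0) := by
        rw [← hodd]
        refine Finset.sum_congr rfl fun k hk => ?_
        have : (k : ℝ) ≤ y := (Nat.le_floor_iff hy).1 (Nat.lt_succ_iff.1 (Finset.mem_range.1 hk))
        rw [if_pos this, mul_one]
    _ ≤ _ := Finset.sum_le_sum_of_subset_of_nonneg (Finset.range_subset_range.2 (by omega))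
        fun k _ _ => by positivity

/-- The fourth moment of the deviation of an order statistic from `i / (n + 1)` is of order
`n ^ (-2)`. -/
theorem IsUniformSample.integral_orderStatistic_le (hx : IsUniformSample P x) (i : Fin n) :
    ∫ ω, ((n : ℝ) * (x (Tuple.sort (fun j => x j ω) i) ω - pseudoDesign n i) ^ 2) ^ 2 ∂P ≤ 8 := by
  have hn : (0 : ℝ) < n := by exact_mod_cast i.pos
  set D : Ω → ℝ := fun ω => x (Tuple.sort (fun j => x j ω) i) ω - pseudoDesign n i with hD
  have hDm : Measurable D := (hx.measurable_orderStatistic i).sub_const _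
  obtain ⟨hδ0, hδ2⟩ := pseudoDesign_mem_Icc i
  have hD1 : ∀ ω, D ω ^ 2 ≤ 1 := fun ω => by
    have h1 := hx.mem (Tuple.sort (fun j => x j ω) i) ω
    rw [sq_le_one_iff_abs_le_one, abs_le]
    exact ⟨by simp only [hD]; linarith [h1.1], by simp only [hD]; linarith [h1.2]⟩
  have hset : ∀ k : ℕ, MeasurableSet {ω | (k : ℝ) ≤ n * D ω ^ 2} := fun k =>
    measurableSet_le measurable_const ((hDm.pow_const 2).const_mul _)
  have htail : ∀ k : ℕ, P.real {ω | (k : ℝ) ≤ n * D ω ^ 2} ≤ 2 * Real.exp (-2 * k) := by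
    intro k
    have h1 := hx.measureReal_orderStatistic_le i (Real.sqrt_nonneg (k / n : ℝ))
    rw [Real.sq_sqrt (by positivity), show -2 * (n : ℝ) * (k / n) = -2 * k by field_simp] at h1
    refine (measureReal_mono ?_).trans h1
    intro ω hω
    have h2 : (k : ℝ) ≤ n * D ω ^ 2 := hω
    refine Real.sqrt_le_iff.2 ⟨abs_nonneg _, ?_⟩
    rw [sq_abs, div_le_iff₀ hn]
    linarith
  have hint : ∀ k : ℕ, Integrable
      (fun ω => (2 * (k : ℝ) + 1) * (if (k : ℝ) ≤ n * D ω ^ 2 then (1 : ℝ) else 0)) P := by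
    intro k
    refine Integrable.const_mul ?_ _
    exact (integrable_const (1 : ℝ)).indicator (hset k)
  calc ∫ ω, ((n : ℝ) * D ω ^ 2) ^ 2 ∂P
      ≤ ∫ ω, ∑ k ∈ Finset.range (n + 1),
          (2 * (k : ℝ) + 1) * (if (k : ℝ) ≤ n * D ω ^ 2 then (1 : ℝ) else 0) ∂P := by
        refine integral_mono_of_nonneg (ae_of_all _ fun ω => sq_nonneg _)
          (integrable_finsetSum _ fun k _ => hint k) (ae_of_all _ fun ω => ?_)
        exact sq_le_sum_odd_indicator (mul_nonneg hn.le (sq_nonneg _))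
          (by nlinarith [hD1 ω])
    _ = ∑ k ∈ Finset.range (n + 1), (2 * (k : ℝ) + 1) * P.real {ω | (k : ℝ) ≤ n * D ω ^ 2} := by
        rw [integral_finsetSum _ fun k _ => hint k]
        refine Finset.sum_congr rfl fun k _ => ?_
        rw [integral_const_mul, ← integral_indicator_one (hset k)]
        rfl
    _ ≤ ∑ k ∈ Finset.range (n + 1), 4 * (1 / 2 : ℝ) ^ k := by
        refine Finset.sum_le_sum fun k _ => ?_
        refine (mul_le_mul_of_nonneg_left (htail k) (by positivity)).trans ?_
        have h1 : (k : ℝ) + 1 ≤ Real.exp k := Real.add_one_le_exp _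
        have h2 : Real.exp (-2 * k) * Real.exp k = Real.exp (-k) := by
          rw [← Real.exp_add]
          congr 1
          ring
        have h3 : Real.exp (-k) ≤ (1 / 2 : ℝ) ^ k := by
          rw [Real.exp_neg, one_div, inv_pow]
          refine inv_anti₀ (by positivity) ?_
          rw [show (k : ℝ) = k * 1 by ring, Real.exp_nat_mul]
          gcongr
          linarith [Real.add_one_le_exp 1]
        have h4 := mul_le_mul_of_nonneg_left h1 (Real.exp_pos (-2 * k)).le
        rw [h2] at h4
        have h5 : 0 ≤ Real.exp (-2 * k) := (Real.exp_pos _).le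
        nlinarith
    _ ≤ 8 := by
        rw [← Finset.mul_sum]
        have := Summable.sum_le_tsum (Finset.range (n + 1)) (f := fun k => (1 / 2 : ℝ) ^ k)
          (fun k _ => by positivity) summable_geometric_two
        rw [tsum_geometric_two] at this
        linarith

/-- The second moment of the number of design points in an interval of length `2 * h`. -/
theorem IsUniformSample.integral_sq_count_le (hx : IsUniformSample P x) (c : ℝ) {h : ℝ}
    (hh : 0 ≤ h) :
    ∫ ω, (∑ j, {u | |u - c| ≤ h}.indicator (fun _ => (1 : ℝ)) (x j ω)) ^ 2 ∂P
      ≤ 2 * (n * h) + 4 * (n * h) ^ 2 := by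
  set A : Set ℝ := {u | |u - c| ≤ h} with hA
  have hAm : MeasurableSet A := measurableSet_le (by fun_prop) measurable_const
  set g : ℝ → ℝ := A.indicator fun _ => (1 : ℝ) with hg
  have hgm : Measurable g := measurable_const.indicator hAm
  have hg0 : ∀ u, 0 ≤ g u := fun u => indicator_nonneg (fun _ _ => zero_le_one) u
  have hg1 : ∀ u, g u ≤ 1 := fun u => indicator_le_self' (fun _ _ => zero_le_one) u
  have hp : ∀ j, ∫ ω, g (x j ω) ∂P ≤ 2 * h := by
    intro j
    have h1 : ∫ ω, g (x j ω) ∂P = ∫ u in Icc (0 : ℝ) 1, g u :=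
      (hx.hasLaw j).integral_comp hgm.aestronglyMeasurable
    rw [h1, hg, integral_indicator hAm, Measure.restrict_restrict hAm, setIntegral_const,
      smul_eq_mul, mul_one]
    have hAeq : A = Icc (c - h) (c + h) := by
      ext u
      rw [hA, mem_ofPred_eq, abs_le, mem_Icc]
      constructor <;> rintro ⟨h2, h3⟩ <;> constructor <;> linarith
    refine (measureReal_mono inter_subset_left (by simp [hAeq])).trans (le_of_eq ?_)
    rw [hAeq, Real.volume_real_Icc_of_le (by linarith)]
    ring
  have hp0 : ∀ j, 0 ≤ ∫ ω, g (x j ω) ∂P := fun j => integral_nonneg fun ω => hg0 _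
  have hint : ∀ j k, Integrable (fun ω => g (x j ω) * g (x k ω)) P := fun j k =>
    Integrable.of_mem_Icc 0 1
      ((hgm.comp (hx.measurable j)).mul (hgm.comp (hx.measurable k))).aemeasurable
      (ae_of_all _ fun ω => ⟨mul_nonneg (hg0 _) (hg0 _), mul_le_one₀ (hg1 _) (hg0 _) (hg1 _)⟩)
  simp only [sq, Finset.sum_mul_sum]
  rw [integral_finsetSum _ fun j _ => integrable_finsetSum _ fun k _ => hint j k]
  have hjk : ∀ j k, ∫ ω, g (x j ω) * g (x k ω) ∂P
      ≤ (if j = k then 2 * h else 0) + 2 * h * (2 * h) := by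
    intro j k
    split_ifs with hjk
    · subst hjk
      refine (integral_mono (hint j j) ?_ fun ω => ?_).trans
        ((hp j).trans (le_add_of_nonneg_right (by positivity)))
      · exact Integrable.of_mem_Icc 0 1 (hgm.comp (hx.measurable j)).aemeasurable
          (ae_of_all _ fun ω => ⟨hg0 _, hg1 _⟩)
      · exact mul_le_of_le_one_left (hg0 _) (hg1 _)
    · rw [zero_add, (hx.indep.indepFun hjk).integral_fun_comp_mul_comp
        (hx.measurable j).aemeasurable (hx.measurable k).aemeasurable
        hgm.aestronglyMeasurable hgm.aestronglyMeasurable]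
      exact mul_le_mul (hp j) (hp k) (hp0 k) (by positivity)
  calc ∑ j, ∫ ω, ∑ k, g (x j ω) * g (x k ω) ∂P
      = ∑ j, ∑ k, ∫ ω, g (x j ω) * g (x k ω) ∂P :=
        Finset.sum_congr rfl fun j _ => integral_finsetSum _ fun k _ => hint j k
    _ ≤ ∑ j : Fin n, ∑ k : Fin n, ((if j = k then 2 * h else 0) + 2 * h * (2 * h)) :=
        Finset.sum_le_sum fun j _ => Finset.sum_le_sum fun k _ => hjk j k
    _ = _ := by
        simp [Finset.sum_add_distrib]
        ring

end Design

/-! ### Noise with coefficients depending on the design -/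

/-- The second moment of a linear combination of centred, pairwise uncorrelated variables whose
coefficients are independent of them: conditionally on `X`, the cross terms vanish. -/
theorem integrable_sq_sum_mul_and_integral_le {Ω E : Type*} [MeasurableSpace Ω] [MeasurableSpace E]
    {P : Measure Ω} [IsProbabilityMeasure P] {n : ℕ} {X : Ω → E} {z : Fin n → Ω → ℝ}
    {G : Fin n → E → ℝ} {v S : ℝ} (hX : Measurable X) (hz : ∀ a, Measurable (z a))
    (hG : ∀ a, Measurable (G a)) (hindep : IndepFun X (fun ω a => z a ω) P)
    (hv : 0 ≤ v) (hzL2 : ∀ a, MemLp (z a) 2 P)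
    (hvar : ∀ a, ∫ ω, z a ω * z a ω ∂P = v)
    (hcov : ∀ a b, a ≠ b → ∫ ω, z a ω * z b ω ∂P = 0)
    (hS : ∀ ω, ∑ a, G a (X ω) ^ 2 ≤ S) :
    Integrable (fun ω => (∑ a, G a (X ω) * z a ω) ^ 2) P ∧
      ∫ ω, (∑ a, G a (X ω) * z a ω) ^ 2 ∂P ≤ v * S := by
  have hzv : Measurable fun ω a => z a ω := measurable_pi_lambda _ hz
  have hGle : ∀ a ω, G a (X ω) ^ 2 ≤ S := fun a ω =>
    (Finset.single_le_sum (f := fun a => G a (X ω) ^ 2) (fun a _ => sq_nonneg _)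
      (Finset.mem_univ a)).trans (hS ω)
  have hGint : ∀ a b, Integrable (fun ω => G a (X ω) * G b (X ω)) P := by
    intro a b
    refine Integrable.of_mem_Icc (-S) S
      (((hG a).comp hX).mul ((hG b).comp hX)).aemeasurable (ae_of_all _ fun ω => ?_)
    exact ⟨by nlinarith [hGle a ω, hGle b ω, sq_nonneg (G a (X ω) + G b (X ω))],
      by nlinarith [hGle a ω, hGle b ω, sq_nonneg (G a (X ω) - G b (X ω))]⟩
  have hzint : ∀ a b, Integrable (fun ω => z a ω * z b ω) P := fun a b =>
    (hzL2 a).integrable_mul (hzL2 b)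
  have hGm : ∀ a b, Measurable fun e => G a e * G b e := fun a b => (hG a).mul (hG b)
  have hzm : ∀ a b, Measurable fun y : Fin n → ℝ => y a * y b := fun a b =>
    (measurable_pi_apply a).mul (measurable_pi_apply b)
  have hprod : ∀ a b, Integrable (fun ω => G a (X ω) * G b (X ω) * (z a ω * z b ω)) P :=
    fun a b => (hindep.comp (hGm a b) (hzm a b)).integrable_mul (hGint a b) (hzint a b)
  have hval : ∀ a b, ∫ ω, G a (X ω) * G b (X ω) * (z a ω * z b ω) ∂P
      = (∫ ω, G a (X ω) * G b (X ω) ∂P) * ∫ ω, z a ω * z b ω ∂P := fun a b =>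
    hindep.integral_fun_comp_mul_comp hX.aemeasurable hzv.aemeasurable
      (hGm a b).aestronglyMeasurable (hzm a b).aestronglyMeasurable
  have hexp : (fun ω => (∑ a, G a (X ω) * z a ω) ^ 2)
      = fun ω => ∑ a, ∑ b, G a (X ω) * G b (X ω) * (z a ω * z b ω) := by
    ext ω
    rw [sq, Finset.sum_mul_sum]
    exact Finset.sum_congr rfl fun a _ => Finset.sum_congr rfl fun b _ => by ring
  have hint : Integrable (fun ω => (∑ a, G a (X ω) * z a ω) ^ 2) P := by
    rw [hexp]
    exact integrable_finsetSum _ fun a _ => integrable_finsetSum _ fun b _ => hprod a b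
  refine ⟨hint, ?_⟩
  rw [hexp, integral_finsetSum _ fun a _ => integrable_finsetSum _ fun b _ => hprod a b]
  have hrow : ∀ a, ∫ ω, ∑ b, G a (X ω) * G b (X ω) * (z a ω * z b ω) ∂P
      = v * ∫ ω, G a (X ω) ^ 2 ∂P := by
    intro a
    rw [integral_finsetSum _ fun b _ => hprod a b, Finset.sum_eq_single a]
    · rw [hval, hvar, mul_comm]
      simp only [sq]
    · intro b _ hb
      rw [hval, hcov a b hb.symm, mul_zero]
    · simp
  rw [Finset.sum_congr rfl fun a _ => hrow a, ← Finset.mul_sum, ← integral_finsetSum]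
  · refine mul_le_mul_of_nonneg_left ?_ hv
    refine (integral_mono_of_nonneg (ae_of_all _ fun ω => Finset.sum_nonneg fun a _ => sq_nonneg _)
      (integrable_const S) (ae_of_all _ hS)).trans ?_
    simp
  · intro a _
    simpa only [sq] using hGint a a

theorem memLp_two_of_hasLaw_gaussianReal {Ω : Type*} [MeasurableSpace Ω] {P : Measure Ω}
    {z : Ω → ℝ} {v : ℝ≥0} (hz : HasLaw z (gaussianReal 0 v) P) : MemLp z 2 P := by
  have h : MemLp id 2 (P.map z) := by
    rw [hz.map_eq]
    exact memLp_id_gaussianReal 2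
  exact (memLp_map_measure_iff h.1 hz.aemeasurable).1 h

theorem integral_eq_zero_of_hasLaw_gaussianReal {Ω : Type*} [MeasurableSpace Ω] {P : Measure Ω}
    {z : Ω → ℝ} {v : ℝ≥0} (hz : HasLaw z (gaussianReal 0 v) P) : ∫ ω, z ω ∂P = 0 := by
  rw [hz.integral_eq, integral_id_gaussianReal]

theorem integral_mul_self_of_hasLaw_gaussianReal {Ω : Type*} [MeasurableSpace Ω] {P : Measure Ω}
    {z : Ω → ℝ} {v : ℝ≥0} (hz : HasLaw z (gaussianReal 0 v) P) : ∫ ω, z ω * z ω ∂P = v := by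
  have h := hz.variance_eq
  rw [variance_of_integral_eq_zero hz.aemeasurable
    (integral_eq_zero_of_hasLaw_gaussianReal hz), variance_id_gaussianReal] at h
  simpa only [sq] using h

/-! ### The local polynomial estimator at a fixed point -/

/-- The coefficient of the `i`-th response in the local polynomial estimate at `t`. -/
noncomputable def localPolyWeight (l : ℕ) (K : ℝ → ℝ) (h : ℝ) (n : ℕ) (t : ℝ) (i : Fin n) : ℝ :=
  leastSquaresWeight (fun i : Fin n => monomialVec l ((pseudoDesign n i - t) / h))
    (fun i => K ((pseudoDesign n i - t) / h)) (monomialVec l 0) i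

theorem measurable_localPolyWeight (l : ℕ) {K : ℝ → ℝ} (hK : Measurable K) (h : ℝ) (n : ℕ)
    (i : Fin n) : Measurable fun t => localPolyWeight l K h n t i := by
  unfold localPolyWeight
  refine measurable_leastSquaresWeight
    (U := fun t (i : Fin n) => monomialVec l ((pseudoDesign n i - t) / h))
    (k := fun t (i : Fin n) => K ((pseudoDesign n i - t) / h)) (fun j a => ?_)
    (fun j => hK.comp (by fun_prop)) _ i
  simp only [monomialVec]
  fun_prop

theorem localPolyWeight_eq_zero (l : ℕ) {K : ℝ → ℝ} (hK : IsLocalPolyKernel K) {h : ℝ}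
    (hh : 0 < h) {n : ℕ} {t : ℝ} {i : Fin n} (hi : ¬ |t - pseudoDesign n i| ≤ h) :
    localPolyWeight l K h n t i = 0 := by
  have h1 : K ((pseudoDesign n i - t) / h) = 0 := by
    refine hK.support _ ?_
    rw [abs_div, abs_of_pos hh, lt_div_iff₀ hh, one_mul, abs_sub_comm]
    exact not_le.1 hi
  unfold localPolyWeight
  exact leastSquaresWeight_eq_zero (k := fun i => K ((pseudoDesign n i - t) / h)) h1 _

section Coercive

variable {l : ℕ} {K : ℝ → ℝ} {h : ℝ} {n : ℕ} {t c : ℝ}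

theorem existsUnique_isLocalPolyFit (hc : 0 < c)
    (hco : ∀ v : Fin (l + 1) → ℝ, c * (v ⬝ᵥ v) ≤ ∑ i : Fin n,
      (v ⬝ᵥ monomialVec l ((pseudoDesign n i - t) / h)) ^ 2 * K ((pseudoDesign n i - t) / h))
    (y : Fin n → ℝ) : ∃! θ, IsLocalPolyFit l K h y t θ := by
  obtain ⟨θ, hθ, -⟩ := exists_unique_leastSquares hc hco y
  exact ⟨θ, (hθ θ).2 rfl, fun θ' h' => (hθ θ').1 h'⟩

theorem localPolyEstimate_eq_sum (hc : 0 < c)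
    (hco : ∀ v : Fin (l + 1) → ℝ, c * (v ⬝ᵥ v) ≤ ∑ i : Fin n,
      (v ⬝ᵥ monomialVec l ((pseudoDesign n i - t) / h)) ^ 2 * K ((pseudoDesign n i - t) / h))
    (y : Fin n → ℝ) :
    localPolyEstimate l K h y t = ∑ i, localPolyWeight l K h n t i * y i := by
  obtain ⟨θ, hθ, hlin⟩ := exists_unique_leastSquares hc hco y
  have h1 : IsLocalPolyFit l K h y t (Classical.epsilon fun θ => IsLocalPolyFit l K h y t θ) :=
    Classical.epsilon_spec (p := fun θ => IsLocalPolyFit l K h y t θ) ⟨θ, (hθ θ).2 rfl⟩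
  rw [localPolyEstimate, (hθ _).1 h1, hlin]
  rfl

theorem sum_localPolyWeight_sq_le (hc : 0 < c)
    (hco : ∀ v : Fin (l + 1) → ℝ, c * (v ⬝ᵥ v) ≤ ∑ i : Fin n,
      (v ⬝ᵥ monomialVec l ((pseudoDesign n i - t) / h)) ^ 2 * K ((pseudoDesign n i - t) / h))
    (hK : IsLocalPolyKernel K) {Kmax : ℝ} (hKmax : ∀ u, K u ≤ Kmax) :
    ∑ i, localPolyWeight l K h n t i ^ 2 ≤ Kmax / c := by
  have h1 := sum_leastSquaresWeight_sq_le hc hco (fun i => hK.nonneg _) (fun i => hKmax _)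
    ((hK.nonneg 0).trans (hKmax 0)) (monomialVec l 0)
  rwa [monomialVec_zero_dotProduct, show monomialVec l 0 0 = 1 by simp [monomialVec], mul_one] at h1

theorem sum_localPolyWeight_mul_monomialVec (hc : 0 < c)
    (hco : ∀ v : Fin (l + 1) → ℝ, c * (v ⬝ᵥ v) ≤ ∑ i : Fin n,
      (v ⬝ᵥ monomialVec l ((pseudoDesign n i - t) / h)) ^ 2 * K ((pseudoDesign n i - t) / h))
    (v : Fin (l + 1) → ℝ) :
    ∑ i, localPolyWeight l K h n t i * (v ⬝ᵥ monomialVec l ((pseudoDesign n i - t) / h)) = v 0 := by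
  rw [← monomialVec_zero_dotProduct l v]
  exact sum_leastSquaresWeight_mul hc hco (monomialVec l 0) v

/-- Cauchy–Schwarz, using that only design points within `h` of `t` receive weight. -/
theorem sq_sum_localPolyWeight_mul_le (hc : 0 < c)
    (hco : ∀ v : Fin (l + 1) → ℝ, c * (v ⬝ᵥ v) ≤ ∑ i : Fin n,
      (v ⬝ᵥ monomialVec l ((pseudoDesign n i - t) / h)) ^ 2 * K ((pseudoDesign n i - t) / h))
    (hK : IsLocalPolyKernel K) (hh : 0 < h) {Kmax : ℝ} (hKmax : ∀ u, K u ≤ Kmax) (r : Fin n → ℝ) :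
    (∑ i, localPolyWeight l K h n t i * r i) ^ 2 ≤
      Kmax / c * ∑ i, {u | |u - pseudoDesign n i| ≤ h}.indicator (fun _ => (1 : ℝ)) t * r i ^ 2 := by
  have h1 : ∀ i, localPolyWeight l K h n t i * r i = localPolyWeight l K h n t i *
      ({u | |u - pseudoDesign n i| ≤ h}.indicator (fun _ => (1 : ℝ)) t * r i) := by
    intro i
    by_cases hi : |t - pseudoDesign n i| ≤ h
    · rw [indicator_of_mem (by exact hi), one_mul]
    · rw [localPolyWeight_eq_zero l hK hh hi, zero_mul, zero_mul]
  have h2 : ∀ i, {u | |u - pseudoDesign n i| ≤ h}.indicator (fun _ => (1 : ℝ)) t * r i ^ 2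
      = ({u | |u - pseudoDesign n i| ≤ h}.indicator (fun _ => (1 : ℝ)) t * r i) ^ 2 := by
    intro i
    by_cases hi : t ∈ {u | |u - pseudoDesign n i| ≤ h} <;> simp [hi]
  simp only [h1, h2]
  refine (Finset.sum_mul_sq_le_sq_mul_sq _ _ _).trans (mul_le_mul_of_nonneg_right ?_
    (Finset.sum_nonneg fun i _ => sq_nonneg _))
  exact sum_localPolyWeight_sq_le hc hco hK hKmax

end Coercive

theorem natCast_pos_of_one_le_mul {n : ℕ} {h : ℝ} (hnh : 1 ≤ n * h) : (0 : ℝ) < n := by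
  rcases Nat.eq_zero_or_pos n with h0 | h0
  · rw [h0] at hnh
    norm_num at hnh
  · exact_mod_cast h0

theorem sum_indicator_pseudoDesign_le {n : ℕ} {h : ℝ} (hh : 0 < h) (hnh : 1 ≤ n * h) (t : ℝ) :
    ∑ i : Fin n, {u | |u - pseudoDesign n i| ≤ h}.indicator (fun _ => (1 : ℝ)) t
      ≤ 5 * (n * h) := by
  have hn : (1 : ℝ) ≤ n := by
    exact_mod_cast Nat.cast_pos.1 (natCast_pos_of_one_le_mul hnh)
  have hn1 : (0 : ℝ) < (n : ℝ) + 1 := by linarith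
  have h1 : ∑ i : Fin n, {u | |u - pseudoDesign n i| ≤ h}.indicator (fun _ => (1 : ℝ)) t
      = ((Finset.univ.filter fun i : Fin n => |t - pseudoDesign n i| ≤ h).card : ℝ) := by
    simp [Set.indicator_apply]
  have h2 : (Finset.univ.filter fun i : Fin n => |t - pseudoDesign n i| ≤ h).card
      ≤ (Finset.Icc ⌈(t - h) * (n + 1)⌉ ⌊(t + h) * (n + 1)⌋).card := by
    refine Finset.card_le_card_of_injOn (fun i => ((i : ℕ) : ℤ) + 1) (fun i hi => ?_)
      (fun i _ j _ hij => ?_)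
    · have h3 := abs_le.1 (Finset.mem_filter.1 hi).2
      have h4 : pseudoDesign n i * (n + 1) = (i : ℕ) + 1 := by rw [pseudoDesign]; field_simp
      refine Finset.mem_coe.2 (Finset.mem_Icc.2 ⟨Int.ceil_le.2 ?_, Int.le_floor.2 ?_⟩)
      · push_cast
        rw [← h4]
        exact mul_le_mul_of_nonneg_right (by linarith [h3.2]) hn1.le
      · push_cast
        rw [← h4]
        exact mul_le_mul_of_nonneg_right (by linarith [h3.1]) hn1.le
    · simp only at hij
      exact Fin.ext (by omega)
  rw [h1]
  refine (Nat.cast_le.2 h2).trans ?_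
  rw [Int.card_Icc]
  have h3 := Int.floor_le ((t + h) * ((n : ℝ) + 1))
  have h4 := Int.le_ceil ((t - h) * ((n : ℝ) + 1))
  have h5 : (((⌊(t + h) * ((n : ℝ) + 1)⌋ + 1 - ⌈(t - h) * ((n : ℝ) + 1)⌉).toNat : ℤ) : ℝ)
      ≤ 5 * (n * h) := by
    rw [Int.toNat_eq_max, Int.cast_max]
    refine max_le ?_ (by push_cast; nlinarith)
    push_cast
    nlinarith
  exact_mod_cast h5

theorem sq_rpow_mul_le {n : ℝ} (hn : 0 < n) {d γ : ℝ} (hγ : 0 ≤ γ) (hγ1 : γ ≤ 1) :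
    (|d| ^ γ) ^ 2 ≤ n ^ (-γ) * (1 + n * d ^ 2) := by
  have h1 : (|d| ^ γ) ^ 2 = n ^ (-γ) * (n * d ^ 2) ^ γ := by
    rw [Real.mul_rpow hn.le (sq_nonneg d), ← mul_assoc, ← Real.rpow_add hn, neg_add_cancel,
      Real.rpow_zero, one_mul, ← sq_abs d, ← Real.rpow_natCast, ← Real.rpow_natCast,
      ← Real.rpow_mul (abs_nonneg d), ← Real.rpow_mul (abs_nonneg d), mul_comm]
  rw [h1]
  refine mul_le_mul_of_nonneg_left ?_ (Real.rpow_nonneg hn.le _)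
  have h2 : 0 ≤ n * d ^ 2 := by positivity
  rcases le_total (n * d ^ 2) 1 with h3 | h3
  · exact (Real.rpow_le_one h2 h3 hγ).trans (by linarith)
  · refine (Real.rpow_le_rpow_of_exponent_le h3 hγ1).trans ?_
    rw [Real.rpow_one]
    linarith

/-- The squared error at `t`, split into the noise, the effect of replacing the design points `ξ i`
by `i / (n + 1)`, and the approximation error of the Taylor polynomial at `t`. -/
theorem sq_localPolyEstimate_sub_le {β L M : ℝ} (hβ : 0 < β) (hL : 0 ≤ L) {f : ℝ → ℝ}
    (hf : f ∈ holderClass β L)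
    (hM : ∀ x ∈ Icc (0 : ℝ) 1, ∀ y ∈ Icc (0 : ℝ) 1, |f x - f y| ≤ M * |x - y| ^ min β 1)
    {K : ℝ → ℝ} (hK : IsLocalPolyKernel K) {Kmax : ℝ} (hKmax : ∀ u, K u ≤ Kmax)
    {n : ℕ} {h t c : ℝ} (hh : 0 < h) (hnh : 1 ≤ n * h) (ht : t ∈ Icc (0 : ℝ) 1) (hc : 0 < c)
    (hco : ∀ v : Fin (strictFloor β + 1) → ℝ, c * (v ⬝ᵥ v) ≤ ∑ i : Fin n,
      (v ⬝ᵥ monomialVec (strictFloor β) ((pseudoDesign n i - t) / h)) ^ 2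
        * K ((pseudoDesign n i - t) / h))
    {ξ ζ : Fin n → ℝ} (hξ : ∀ i, ξ i ∈ Icc (0 : ℝ) 1) :
    (localPolyEstimate (strictFloor β) K h (fun i => f (ξ i) + ζ i) t - f t) ^ 2
      ≤ 3 * (∑ i, localPolyWeight (strictFloor β) K h n t i * ζ i) ^ 2
        + 3 * (Kmax / c) * (M ^ 2 * (n : ℝ) ^ (-min β 1))
          * ∑ i, {u | |u - pseudoDesign n i| ≤ h}.indicator (fun _ => (1 : ℝ)) t
            * (1 + n * (ξ i - pseudoDesign n i) ^ 2)
        + 15 * (Kmax / c) * (n * h) * L ^ 2 * (h ^ β) ^ 2 := by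
  have hn : (0 : ℝ) < n := natCast_pos_of_one_le_mul hnh
  have hS : 0 ≤ Kmax / c := div_nonneg ((hK.nonneg 0).trans (hKmax 0)) hc.le
  have hind : ∀ i : Fin n,
      0 ≤ {u | |u - pseudoDesign n i| ≤ h}.indicator (fun _ => (1 : ℝ)) t := fun i =>
    indicator_nonneg (fun _ _ => zero_le_one) t
  set W := localPolyWeight (strictFloor β) K h n t with hW
  set v : Fin (strictFloor β + 1) → ℝ := fun k =>
    iteratedDerivWithin k f (Icc 0 1) t * h ^ (k : ℕ) with hv
  have hv0 : v 0 = f t := by simp [hv]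
  have hsplit : localPolyEstimate (strictFloor β) K h (fun i => f (ξ i) + ζ i) t - f t
      = ∑ i, W i * ζ i + ∑ i, W i * (f (ξ i) - f (pseudoDesign n i))
        + ∑ i, W i * (f (pseudoDesign n i)
          - v ⬝ᵥ monomialVec (strictFloor β) ((pseudoDesign n i - t) / h)) := by
    rw [localPolyEstimate_eq_sum hc hco, ← hv0,
      ← sum_localPolyWeight_mul_monomialVec hc hco v, ← Finset.sum_sub_distrib,
      ← Finset.sum_add_distrib, ← Finset.sum_add_distrib]
    exact Finset.sum_congr rfl fun i _ => by ring
  have hdesign : (∑ i, W i * (f (ξ i) - f (pseudoDesign n i))) ^ 2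
      ≤ (Kmax / c) * (M ^ 2 * (n : ℝ) ^ (-min β 1))
        * ∑ i, {u | |u - pseudoDesign n i| ≤ h}.indicator (fun _ => (1 : ℝ)) t
          * (1 + n * (ξ i - pseudoDesign n i) ^ 2) := by
    refine (sq_sum_localPolyWeight_mul_le hc hco hK hh hKmax _).trans ?_
    rw [mul_assoc (Kmax / c), Finset.mul_sum _ _ (M ^ 2 * (n : ℝ) ^ (-min β 1))]
    refine mul_le_mul_of_nonneg_left (Finset.sum_le_sum fun i _ => ?_) hS
    rw [mul_left_comm]
    refine mul_le_mul_of_nonneg_left ?_ (hind i)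
    have h1 := hM _ (hξ i) _ (pseudoDesign_mem_Icc i)
    have h2 := pow_le_pow_left₀ (abs_nonneg _) h1 2
    rw [sq_abs, mul_pow] at h2
    refine h2.trans ?_
    rw [mul_assoc]
    exact mul_le_mul_of_nonneg_left
      (sq_rpow_mul_le hn (le_min hβ.le zero_le_one) (min_le_right _ _)) (sq_nonneg M)
  have hbias : (∑ i, W i * (f (pseudoDesign n i)
        - v ⬝ᵥ monomialVec (strictFloor β) ((pseudoDesign n i - t) / h))) ^ 2
      ≤ 5 * (Kmax / c) * (n * h) * L ^ 2 * (h ^ β) ^ 2 := by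
    refine (sq_sum_localPolyWeight_mul_le hc hco hK hh hKmax _).trans ?_
    have h1 : ∑ i, {u | |u - pseudoDesign n i| ≤ h}.indicator (fun _ => (1 : ℝ)) t
        * (f (pseudoDesign n i)
          - v ⬝ᵥ monomialVec (strictFloor β) ((pseudoDesign n i - t) / h)) ^ 2
        ≤ ∑ i, {u | |u - pseudoDesign n i| ≤ h}.indicator (fun _ => (1 : ℝ)) t
          * (L * h ^ β) ^ 2 := by
      refine Finset.sum_le_sum fun i _ => ?_
      by_cases hi : t ∈ {u | |u - pseudoDesign n i| ≤ h}
      · refine mul_le_mul_of_nonneg_left ?_ (hind i)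
        have h2 := abs_sub_taylor_le_of_mem_holderClass hβ hL hf hh.ne' ht (pseudoDesign_mem_Icc i)
        rw [← sq_abs]
        refine pow_le_pow_left₀ (abs_nonneg _) (h2.trans (mul_le_mul_of_nonneg_left ?_ hL)) 2
        refine Real.rpow_le_rpow (abs_nonneg _) ?_ hβ.le
        rw [abs_sub_comm]
        exact hi
      · rw [indicator_of_notMem hi, zero_mul, zero_mul]
    rw [← Finset.sum_mul] at h1
    have h2 := mul_le_mul_of_nonneg_right (sum_indicator_pseudoDesign_le hh hnh t)
      (sq_nonneg (L * h ^ β))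
    refine (mul_le_mul_of_nonneg_left (h1.trans h2) hS).trans (le_of_eq ?_)
    ring
  rw [hsplit]
  set a := ∑ i, W i * ζ i
  set b := ∑ i, W i * (f (ξ i) - f (pseudoDesign n i))
  set d := ∑ i, W i * (f (pseudoDesign n i)
          - v ⬝ᵥ monomialVec (strictFloor β) ((pseudoDesign n i - t) / h))
  nlinarith [sq_nonneg (a - b), sq_nonneg (a - d), sq_nonneg (b - d)]

/-! ### The risk bound -/

theorem modifiedLocalPoly_eq {l : ℕ} {K : ℝ → ℝ} {h : ℝ} {n : ℕ} (x : Fin n → ℝ) (f : ℝ → ℝ)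
    (z : Fin n → ℝ) (t : ℝ) :
    modifiedLocalPoly l K h x (fun i => f (x i) + z i) t
      = localPolyEstimate l K h (fun i => f (x (Tuple.sort x i)) + z (Tuple.sort x i)) t := rfl

theorem continuousOn_of_abs_sub_le_rpow {f : ℝ → ℝ} {s : Set ℝ} {M γ : ℝ} (hγ : 0 < γ)
    (hM : ∀ x ∈ s, ∀ y ∈ s, |f x - f y| ≤ M * |x - y| ^ γ) : ContinuousOn f s := by
  intro u hu
  rw [ContinuousWithinAt, tendsto_iff_dist_tendsto_zero]
  have hlim : Filter.Tendsto (fun y => M * |y - u| ^ γ) (nhdsWithin u s) (nhds 0) := by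
    have : Continuous fun y => M * |y - u| ^ γ :=
      continuous_const.mul (Continuous.rpow_const (by fun_prop) fun _ => Or.inr hγ.le)
    have h1 := this.tendsto u
    rw [sub_self, abs_zero, Real.zero_rpow hγ.ne', mul_zero] at h1
    exact h1.mono_left nhdsWithin_le_nhds
  refine squeeze_zero' (Filter.Eventually.of_forall fun _ => dist_nonneg) ?_ hlim
  filter_upwards [self_mem_nhdsWithin] with y hy
  exact hM y hy u hu

theorem IsUniformSample.measurable_comp {Ω : Type*} [MeasurableSpace Ω] {P : Measure Ω} {n : ℕ}
    {x : Fin n → Ω → ℝ} (hx : IsUniformSample P x) {f : ℝ → ℝ} (hf : ContinuousOn f (Icc 0 1))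
    (j : Fin n) : Measurable fun ω => f (x j ω) :=
  (continuousOn_iff_continuous_domRestrict.1 hf).measurable.comp
    ((hx.measurable j).subtype_mk (h := hx.mem j))

/-- The noise part of a linear estimator at a design point. The weights may be attached to the
unsorted errors by undoing the sorting permutation, which depends on the design only. -/
theorem IsUniformSample.integrable_sq_noise_and_integral_le {Ω : Type*} [MeasurableSpace Ω]
    {P : Measure Ω} [IsProbabilityMeasure P] {n : ℕ} {x z : Fin n → Ω → ℝ}
    (hx : IsUniformSample P x) (hzm : ∀ i, Measurable (z i)) {v : ℝ≥0}
    (hz : ∀ i, HasLaw (z i) (gaussianReal 0 v) P) (hzind : iIndepFun z P)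
    (hxz : IndepFun (fun ω i => x i ω) (fun ω i => z i ω) P) {W : ℝ → Fin n → ℝ}
    (hW : ∀ i, Measurable fun t => W t i) {S : ℝ}
    (hS : ∀ t ∈ Icc (0 : ℝ) 1, ∑ i, W t i ^ 2 ≤ S) (j : Fin n) :
    Integrable (fun ω => (∑ i, W (x j ω) i * z (Tuple.sort (fun i => x i ω) i) ω) ^ 2) P ∧
      ∫ ω, (∑ i, W (x j ω) i * z (Tuple.sort (fun i => x i ω) i) ω) ^ 2 ∂P ≤ v * S := by
  set G : Fin n → (Fin n → ℝ) → ℝ := fun a e => W (e j) ((Tuple.sort e).symm a) with hG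
  have hGm : ∀ a, Measurable (G a) := fun a =>
    measurable_apply_sort (x := fun i (e : Fin n → ℝ) => e i) measurable_pi_apply
      (g := fun π e => W (e j) (π.symm a)) fun π => (hW _).comp (measurable_pi_apply j)
  have hT : ∀ ω, ∑ i, W (x j ω) i * z (Tuple.sort (fun i => x i ω) i) ω
      = ∑ a, G a (fun i => x i ω) * z a ω := by
    intro ω
    rw [← Equiv.sum_comp (Tuple.sort fun i => x i ω) fun a => G a (fun i => x i ω) * z a ω]
    simp only [hG, Equiv.symm_apply_apply]
  simp only [hT]
  refine integrable_sq_sum_mul_and_integral_le (measurable_pi_lambda _ hx.measurable) hzm hGm hxz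
    (NNReal.coe_nonneg v) (fun a => memLp_two_of_hasLaw_gaussianReal (hz a))
    (fun a => integral_mul_self_of_hasLaw_gaussianReal (hz a)) (fun a b hab => ?_) (fun ω => ?_)
  · rw [(hzind.indepFun hab).integral_fun_mul_eq_mul_integral
      (hzm a).aestronglyMeasurable (hzm b).aestronglyMeasurable,
      integral_eq_zero_of_hasLaw_gaussianReal (hz a), zero_mul]
  · simp only [hG]
    rw [Equiv.sum_comp (Tuple.sort fun i => x i ω).symm fun i => W (x j ω) i ^ 2]
    exact hS _ (hx.mem j ω)

/-- The risk bound for a sample that takes its values in `[0, 1]`, with explicit constants. -/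
theorem IsUniformSample.integrable_loss_and_integral_le {Ω : Type*} [MeasurableSpace Ω]
    {P : Measure Ω} [IsProbabilityMeasure P] {n : ℕ} {x z : Fin n → Ω → ℝ}
    (hx : IsUniformSample P x) (hzm : ∀ i, Measurable (z i)) {σ : ℝ≥0}
    (hz : ∀ i, HasLaw (z i) (gaussianReal 0 (σ ^ 2)) P) (hzind : iIndepFun z P)
    (hxz : IndepFun (fun ω i => x i ω) (fun ω i => z i ω) P)
    {β L M : ℝ} (hβ : 0 < β) (hL : 0 ≤ L) {f : ℝ → ℝ} (hf : f ∈ holderClass β L)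
    (hM : ∀ x ∈ Icc (0 : ℝ) 1, ∀ y ∈ Icc (0 : ℝ) 1, |f x - f y| ≤ M * |x - y| ^ min β 1)
    {K : ℝ → ℝ} (hK : IsLocalPolyKernel K) {Kmax : ℝ} (hKmax : ∀ u, K u ≤ Kmax)
    {h c : ℝ} (hh : 0 < h) (hnh : 1 ≤ n * h) (hc : 0 < c)
    (hco : ∀ t ∈ Icc (0 : ℝ) 1, ∀ v : Fin (strictFloor β + 1) → ℝ,
      c * (n * h) * (v ⬝ᵥ v) ≤ ∑ i : Fin n,
        (v ⬝ᵥ monomialVec (strictFloor β) ((pseudoDesign n i - t) / h)) ^ 2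
          * K ((pseudoDesign n i - t) / h)) :
    Integrable (fun ω => empiricalNormSq (fun i => x i ω) (fun t =>
        modifiedLocalPoly (strictFloor β) K h (fun i => x i ω)
          (fun i => f (x i ω) + z i ω) t - f t)) P ∧
      ∫ ω, empiricalNormSq (fun i => x i ω) (fun t =>
        modifiedLocalPoly (strictFloor β) K h (fun i => x i ω)
          (fun i => f (x i ω) + z i ω) t - f t) ∂P
        ≤ Kmax / c * (3 * σ ^ 2 / (n * h) + 72 * M ^ 2 * (n : ℝ) ^ (-min β 1)
          + 15 * L ^ 2 * (h ^ β) ^ 2) := by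
  have hn : (0 : ℝ) < n := natCast_pos_of_one_le_mul hnh
  have hnh0 : (0 : ℝ) < n * h := by positivity
  have hcn : 0 < c * (n * h) := by positivity
  have hKmax0 : 0 ≤ Kmax := (hK.nonneg 0).trans (hKmax 0)
  set S : ℝ := Kmax / (c * (n * h)) with hS
  have hS0 : 0 ≤ S := div_nonneg hKmax0 hcn.le
  have hSnh : S * (n * h) = Kmax / c := by rw [hS]; field_simp
  set W := localPolyWeight (strictFloor β) K h n with hW
  have hWm : ∀ i, Measurable fun t => W t i := measurable_localPolyWeight _ hK.measurable h n
  set q : ℝ := M ^ 2 * (n : ℝ) ^ (-min β 1) with hq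
  have hq0 : 0 ≤ q := by positivity
  have hfx : ∀ j, Measurable fun ω => f (x j ω) := hx.measurable_comp
    (continuousOn_of_abs_sub_le_rpow (lt_min hβ zero_lt_one) hM)
  set loss : Ω → ℝ := fun ω => empiricalNormSq (fun i => x i ω) (fun t =>
        modifiedLocalPoly (strictFloor β) K h (fun i => x i ω)
          (fun i => f (x i ω) + z i ω) t - f t) with hloss
  have hloss_eq : loss = fun ω => 1 / (n : ℝ) * ∑ j, (∑ i, W (x j ω) i *
      (f (x (Tuple.sort (fun i => x i ω) i) ω) + z (Tuple.sort (fun i => x i ω) i) ω)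
        - f (x j ω)) ^ 2 := by
    ext ω
    simp only [hloss, empiricalNormSq]
    congr 1
    refine Finset.sum_congr rfl fun j _ => ?_
    rw [modifiedLocalPoly_eq (fun i => x i ω) f (fun i => z i ω),
      localPolyEstimate_eq_sum hcn (hco _ (hx.mem j ω))]
  have hloss_meas : Measurable loss := by
    rw [hloss_eq]
    refine (Finset.measurable_fun_sum _ fun j _ => ((Finset.measurable_fun_sum _
      fun i _ => ?_).sub (hfx j)).pow_const 2).const_mul _
    exact measurable_apply_sort hx.measurable
      (g := fun π ω => W (x j ω) i * (f (x (π i) ω) + z (π i) ω))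
      fun π => ((hWm i).comp (hx.measurable j)).mul ((hfx (π i)).add (hzm (π i)))
  have hloss_nonneg : ∀ ω, 0 ≤ loss ω := fun ω => by
    rw [hloss_eq]
    positivity
  set T : Fin n → Ω → ℝ := fun j ω => ∑ i, W (x j ω) i * z (Tuple.sort (fun i => x i ω) i) ω with hT
  have hnoise : ∀ j, Integrable (fun ω => T j ω ^ 2) P ∧
      ∫ ω, T j ω ^ 2 ∂P ≤ ((σ ^ 2 : ℝ≥0) : ℝ) * S :=
    hx.integrable_sq_noise_and_integral_le hzm hz hzind hxz hWm
      fun t ht => sum_localPolyWeight_sq_le hcn (hco t ht) hK hKmax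
  -- the counts of design points near `i / (n + 1)` and the deviations of the order statistics
  set N : Fin n → Ω → ℝ := fun i ω =>
    ∑ j, {u | |u - pseudoDesign n i| ≤ h}.indicator (fun _ => (1 : ℝ)) (x j ω) with hN
  set Y : Fin n → Ω → ℝ := fun i ω =>
    n * (x (Tuple.sort (fun i => x i ω) i) ω - pseudoDesign n i) ^ 2 with hY
  have hNm : ∀ i, Measurable (N i) := fun i =>
    Finset.measurable_fun_sum _ fun j _ => (measurable_const.indicator
      (measurableSet_le (by fun_prop) measurable_const)).comp (hx.measurable j)
  have hYm : ∀ i, Measurable (Y i) := fun i =>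
    (((hx.measurable_orderStatistic i).sub_const _).pow_const 2).const_mul _
  have hNint : ∀ i, Integrable (fun ω => N i ω ^ 2) P := by
    intro i
    refine Integrable.of_mem_Icc 0 ((n : ℝ) ^ 2) ((hNm i).pow_const 2).aemeasurable
      (ae_of_all _ fun ω => ⟨sq_nonneg _, ?_⟩)
    refine pow_le_pow_left₀
      (Finset.sum_nonneg fun j _ => indicator_nonneg (fun _ _ => zero_le_one) _) ?_ 2
    refine (Finset.sum_le_sum fun j _ => indicator_le_self' (fun _ _ => zero_le_one) _).trans ?_
    simp
  have hYint : ∀ i, Integrable (fun ω => Y i ω ^ 2) P := by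
    intro i
    refine Integrable.of_mem_Icc 0 ((n : ℝ) ^ 2) ((hYm i).pow_const 2).aemeasurable
      (ae_of_all _ fun ω => ⟨sq_nonneg _, ?_⟩)
    refine pow_le_pow_left₀ (by positivity) (mul_le_of_le_one_right hn.le ?_) 2
    have h1 := hx.mem (Tuple.sort (fun j => x j ω) i) ω
    have h2 := pseudoDesign_mem_Icc i
    rw [sq_le_one_iff_abs_le_one, abs_le]
    exact ⟨by linarith [h1.1, h2.2], by linarith [h1.2, h2.1]⟩
  set b : ℝ := 15 * S * (n * h) * L ^ 2 * (h ^ β) ^ 2 with hb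
  set D : Ω → ℝ := fun ω => 1 / (n : ℝ) * (∑ j, 3 * T j ω ^ 2
    + 3 * S * q * ∑ i, (N i ω ^ 2 / (n * h) + n * h * (2 + 2 * Y i ω ^ 2))) + b with hD
  have hle : ∀ ω, loss ω ≤ D ω := by
    intro ω
    have h1 : ∀ j, (modifiedLocalPoly (strictFloor β) K h (fun i => x i ω)
          (fun i => f (x i ω) + z i ω) (x j ω) - f (x j ω)) ^ 2
        ≤ 3 * T j ω ^ 2 + 3 * S * q *
          ∑ i, {u | |u - pseudoDesign n i| ≤ h}.indicator (fun _ => (1 : ℝ)) (x j ω)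
            * (1 + Y i ω) + b := fun j =>
      sq_localPolyEstimate_sub_le hβ hL hf hM hK hKmax hh hnh (hx.mem j ω) hcn
        (hco _ (hx.mem j ω)) (ξ := fun i => x (Tuple.sort (fun i => x i ω) i) ω)
        (ζ := fun i => z (Tuple.sort (fun i => x i ω) i) ω) fun i => hx.mem _ ω
    have h2 : ∑ j, ∑ i, {u | |u - pseudoDesign n i| ≤ h}.indicator (fun _ => (1 : ℝ)) (x j ω)
            * (1 + Y i ω) ≤ ∑ i, (N i ω ^ 2 / (n * h) + n * h * (2 + 2 * Y i ω ^ 2)) := by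
      -- `N i` and `Y i` are dependent; the weight `n * h` balances the two second moments
      rw [Finset.sum_comm]
      refine Finset.sum_le_sum fun i _ => ?_
      rw [← Finset.sum_mul]
      change N i ω * (1 + Y i ω) ≤ _
      rw [div_add' _ _ _ hnh0.ne', le_div_iff₀ hnh0]
      nlinarith [sq_nonneg (N i ω - n * h * (1 + Y i ω)),
        mul_nonneg (sq_nonneg (n * h)) (sq_nonneg (1 - Y i ω)), sq_nonneg (N i ω),
        mul_nonneg (sq_nonneg (n * h)) (sq_nonneg (1 + Y i ω))]
    have h3 := Finset.sum_le_sum fun j (_ : j ∈ Finset.univ) => h1 j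
    rw [Finset.sum_add_distrib, Finset.sum_add_distrib, ← Finset.mul_sum _ _ (3 * S * q),
      Finset.sum_const, Finset.card_univ, Fintype.card_fin, nsmul_eq_mul] at h3
    have h4 := mul_le_mul_of_nonneg_left h2 (show 0 ≤ 3 * S * q by positivity)
    have h5 := mul_le_mul_of_nonneg_left (h3.trans (add_le_add_left (add_le_add_right h4 _) _))
      (show 0 ≤ 1 / (n : ℝ) by positivity)
    refine h5.trans (le_of_eq ?_)
    simp only [hD]
    field_simp
  have hTint : Integrable (fun ω => ∑ j, 3 * T j ω ^ 2) P :=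
    integrable_finsetSum _ fun j _ => (hnoise j).1.const_mul 3
  have hYint' : ∀ i, Integrable (fun ω => 2 + 2 * Y i ω ^ 2) P := fun i =>
    (integrable_const 2).add ((hYint i).const_mul 2)
  have hNYint : ∀ i, Integrable (fun ω => N i ω ^ 2 / (n * h) + n * h * (2 + 2 * Y i ω ^ 2)) P :=
    fun i => ((hNint i).div_const _).add ((hYint' i).const_mul _)
  have hNYsum : Integrable (fun ω => 3 * S * q *
      ∑ i, (N i ω ^ 2 / (n * h) + n * h * (2 + 2 * Y i ω ^ 2))) P :=
    (integrable_finsetSum _ fun i _ => hNYint i).const_mul _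
  have hsum : Integrable (fun ω => ∑ j, 3 * T j ω ^ 2
      + 3 * S * q * ∑ i, (N i ω ^ 2 / (n * h) + n * h * (2 + 2 * Y i ω ^ 2))) P :=
    hTint.add hNYsum
  have hDint : Integrable D P := (hsum.const_mul _).add (integrable_const b)
  have hlint : Integrable loss P := hDint.mono' hloss_meas.aestronglyMeasurable
    (ae_of_all _ fun ω => by rw [Real.norm_of_nonneg (hloss_nonneg ω)]; exact hle ω)
  refine ⟨hlint, (integral_mono hlint hDint hle).trans ?_⟩
  have hI : ∫ ω, D ω ∂P = 1 / (n : ℝ) * (∑ j, 3 * ∫ ω, T j ω ^ 2 ∂P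
      + 3 * S * q * ∑ i, ((∫ ω, N i ω ^ 2 ∂P) / (n * h)
        + n * h * (2 + 2 * ∫ ω, Y i ω ^ 2 ∂P))) + b := by
    simp only [hD]
    rw [integral_add (hsum.const_mul _) (integrable_const b), integral_const_mul,
      integral_add hTint hNYsum, integral_finsetSum _ fun j _ => (hnoise j).1.const_mul 3,
      integral_const_mul (3 * S * q), integral_finsetSum _ fun i _ => hNYint i]
    congr 1
    · congr 2
      · exact Finset.sum_congr rfl fun j _ => integral_const_mul _ _
      · congr 1
        refine Finset.sum_congr rfl fun i _ => ?_
        rw [integral_add ((hNint i).div_const _) ((hYint' i).const_mul _),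
          integral_div, integral_const_mul, integral_add (integrable_const _)
          ((hYint i).const_mul 2), integral_const_mul]
        simp
    · simp
  rw [hI]
  have h1 : ∑ j, 3 * ∫ ω, T j ω ^ 2 ∂P ≤ n * (3 * ((σ : ℝ) ^ 2 * S)) := by
    refine (Finset.sum_le_card_nsmul _ _ (3 * ((σ : ℝ) ^ 2 * S)) fun j _ => ?_).trans ?_
    · exact mul_le_mul_of_nonneg_left (by simpa using (hnoise j).2) (by norm_num)
    · simp
  have h2 : ∑ i, ((∫ ω, N i ω ^ 2 ∂P) / (n * h) + n * h * (2 + 2 * ∫ ω, Y i ω ^ 2 ∂P))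
      ≤ n * (24 * (n * h)) := by
    refine (Finset.sum_le_card_nsmul _ _ (24 * (n * h)) fun i _ => ?_).trans ?_
    · have h3 : ∫ ω, N i ω ^ 2 ∂P ≤ 2 * (n * h) + 4 * (n * h) ^ 2 :=
        hx.integral_sq_count_le (pseudoDesign n i) hh.le
      have h4 : ∫ ω, Y i ω ^ 2 ∂P ≤ 8 := hx.integral_orderStatistic_le i
      have h5 : (∫ ω, N i ω ^ 2 ∂P) / (n * h) ≤ 6 * (n * h) := by
        rw [div_le_iff₀ hnh0]
        nlinarith
      nlinarith
    · simp
  have h3 := mul_le_mul_of_nonneg_left h2 (show 0 ≤ 3 * S * q by positivity)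
  have h4 := mul_le_mul_of_nonneg_left (add_le_add h1 h3) (show 0 ≤ 1 / (n : ℝ) by positivity)
  refine (add_le_add_left h4 b).trans (le_of_eq ?_)
  have h5 : 1 / (n : ℝ) * (n * (3 * ((σ : ℝ) ^ 2 * S)) + 3 * S * q * (n * (24 * (n * h)))) + b
      = S * (n * h) * (3 * σ ^ 2 / (n * h) + 72 * q + 15 * L ^ 2 * (h ^ β) ^ 2) := by
    rw [hb]
    field_simp
    ring
  rw [h5, hSnh, hq]
  ring

/-- Replacing the data by almost surely equal versions: the errors become measurable, and the
design points become measurable with values in `[0, 1]` everywhere. -/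
theorem exists_isUniformSample_ae_eq {Ω : Type*} [MeasurableSpace Ω] {P : Measure Ω}
    [IsProbabilityMeasure P] {n : ℕ} {x z : Fin n → Ω → ℝ} {v : ℝ≥0}
    (hx : ∀ i, HasLaw (x i) (volume.restrict (Icc (0 : ℝ) 1)) P)
    (hz : ∀ i, HasLaw (z i) (gaussianReal 0 v) P) (hind : iIndepFun (Sum.elim x z) P) :
    ∃ x' z' : Fin n → Ω → ℝ, IsUniformSample P x' ∧ (∀ i, Measurable (z' i)) ∧
      (∀ i, HasLaw (z' i) (gaussianReal 0 v) P) ∧ iIndepFun z' P ∧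
      IndepFun (fun ω i => x' i ω) (fun ω i => z' i ω) P ∧
      (∀ i, x' i =ᵐ[P] x i) ∧ ∀ i, z' i =ᵐ[P] z i := by
  set x' : Fin n → Ω → ℝ := fun i ω =>
    (projIcc 0 1 zero_le_one ((hx i).aemeasurable.mk (x i) ω) : ℝ) with hx'
  set z' : Fin n → Ω → ℝ := fun i => (hz i).aemeasurable.mk (z i) with hz'
  have hxm : ∀ i, Measurable (x' i) := fun i =>
    (continuous_subtype_val.comp continuous_projIcc).measurable.comp
      (hx i).aemeasurable.measurable_mk
  have hzm : ∀ i, Measurable (z' i) := fun i => (hz i).aemeasurable.measurable_mk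
  have hxe : ∀ i, x' i =ᵐ[P] x i := by
    intro i
    have hmem : ∀ᵐ ω ∂P, x i ω ∈ Icc (0 : ℝ) 1 := by
      refine ae_of_ae_map (hx i).aemeasurable (p := fun u => u ∈ Icc (0 : ℝ) 1) ?_
      rw [(hx i).map_eq]
      exact ae_restrict_mem measurableSet_Icc
    filter_upwards [hmem, (hx i).aemeasurable.ae_eq_mk] with ω h1 h2
    simp only [hx']
    rw [← h2, projIcc_of_mem _ h1]
  have hze : ∀ i, z' i =ᵐ[P] z i := fun i => (hz i).aemeasurable.ae_eq_mk.symm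
  have hind' : iIndepFun (Sum.elim x' z') P := by
    refine hind.congr fun i => ?_
    rcases i with i | i
    · exact (hxe i).symm
    · exact (hze i).symm
  have hm : ∀ i, Measurable (Sum.elim x' z' i) := by
    rintro (i | i)
    · exact hxm i
    · exact hzm i
  refine ⟨x', z', ⟨hxm, fun i ω => (projIcc 0 1 zero_le_one _).2, fun i => (hx i).congr (hxe i),
    hind'.precomp Sum.inl_injective⟩, hzm, fun i => (hz i).congr (hze i),
    hind'.precomp Sum.inr_injective, ?_, hxe, hze⟩
  have h1 := hind'.indepFun_finset (Finset.univ.image Sum.inl) (Finset.univ.image Sum.inr)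
    (by
      rw [Finset.disjoint_left]
      intro a ha hb
      obtain ⟨i, -, rfl⟩ := Finset.mem_image.1 ha
      obtain ⟨j, -, h⟩ := Finset.mem_image.1 hb
      cases h) hm
  exact h1.comp
    (φ := fun e i => e ⟨Sum.inl i, Finset.mem_image_of_mem _ (Finset.mem_univ i)⟩)
    (ψ := fun e i => e ⟨Sum.inr i, Finset.mem_image_of_mem _ (Finset.mem_univ i)⟩)
    (measurable_pi_lambda _ fun i => measurable_pi_apply _)
    (measurable_pi_lambda _ fun i => measurable_pi_apply _)

/-! ### The optimal bandwidth -/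

theorem le_mul_of_bandwidth {β c₁ h : ℝ} (hβ : 0 < β) {n : ℕ} (hn : 0 < n)
    (h1 : c₁ * (n : ℝ) ^ (-1 / (2 * β + 1)) ≤ h) :
    c₁ * (n : ℝ) ^ (2 * β / (1 + 2 * β)) ≤ n * h := by
  have hn' : (0 : ℝ) < n := by exact_mod_cast hn
  refine le_trans (le_of_eq ?_) (mul_le_mul_of_nonneg_left h1 hn'.le)
  rw [mul_left_comm]
  congr 1
  conv_rhs => rw [← Real.rpow_one (n : ℝ), ← Real.rpow_mul hn'.le, ← Real.rpow_add hn']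
  congr 1
  field_simp
  ring

/-- For large `n`, all bandwidths considered are small, while the window of width `h` contains as
many design points as desired. -/
theorem exists_forall_bandwidth {β c₁ c₂ Δ A : ℝ} (hβ : 0 < β) (hc₁ : 0 < c₁) (hΔ : 0 < Δ) :
    ∃ n₀ : ℕ, 1 ≤ n₀ ∧ ∀ n : ℕ, n₀ ≤ n → ∀ h : ℝ,
      c₁ * (n : ℝ) ^ (-1 / (2 * β + 1)) ≤ h → h ≤ c₂ * (n : ℝ) ^ (-1 / (2 * β + 1)) →
      0 < h ∧ Δ * h ≤ 1 / 2 ∧ A ≤ n * h := by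
  have hexp : 0 < 2 * β / (1 + 2 * β) := by positivity
  have hexp' : 0 < 1 / (2 * β + 1) := by positivity
  have hlim1 : Filter.Tendsto (fun n : ℕ => Δ * (c₂ * (n : ℝ) ^ (-1 / (2 * β + 1)))) Filter.atTop
      (nhds 0) := by
    have h1 := ((tendsto_rpow_neg_atTop hexp').comp tendsto_natCast_atTop_atTop).const_mul (Δ * c₂)
    rw [mul_zero] at h1
    refine h1.congr fun n => ?_
    simp only [Function.comp, neg_div]
    ring
  have hlim2 : Filter.Tendsto (fun n : ℕ => c₁ * (n : ℝ) ^ (2 * β / (1 + 2 * β))) Filter.atTop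
      Filter.atTop :=
    ((tendsto_rpow_atTop hexp).comp tendsto_natCast_atTop_atTop).const_mul_atTop hc₁
  obtain ⟨n₀, hn₀⟩ := Filter.eventually_atTop.1
    ((hlim1.eventually_le_const (show (0 : ℝ) < 1 / 2 by norm_num)).and
      (hlim2.eventually_ge_atTop A))
  refine ⟨max n₀ 1, le_max_right _ _, fun n hn h h1 h2 => ?_⟩
  have hnpos : 0 < n := lt_of_lt_of_le (by norm_num) ((le_max_right n₀ 1).trans hn)
  have hn' : (0 : ℝ) < n := by exact_mod_cast hnpos
  obtain ⟨h3, h4⟩ := hn₀ n ((le_max_left _ _).trans hn)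
  exact ⟨lt_of_lt_of_le (by positivity) h1, (mul_le_mul_of_nonneg_left h2 hΔ.le).trans h3,
    h4.trans (le_mul_of_bandwidth hβ hnpos h1)⟩

/-- With the optimal bandwidth each of the three error terms is of the optimal order. The design
term `n ^ (-min β 1)` is, because `1 / 2 ≤ β`. -/
theorem risk_bound_le_rate {β c₁ c₂ h a b d : ℝ} (hβ : 1 / 2 ≤ β) (hc₁ : 0 < c₁) (ha : 0 ≤ a)
    (hb : 0 ≤ b) (hd : 0 ≤ d) {n : ℕ} (hn : 0 < n)
    (h1 : c₁ * (n : ℝ) ^ (-1 / (2 * β + 1)) ≤ h) (h2 : h ≤ c₂ * (n : ℝ) ^ (-1 / (2 * β + 1))) :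
    a / (n * h) + b * (n : ℝ) ^ (-min β 1) + d * (h ^ β) ^ 2
      ≤ (a / c₁ + b + d * (c₂ ^ β) ^ 2) * (n : ℝ) ^ (-(2 * β) / (1 + 2 * β)) := by
  have hβ0 : 0 < β := by linarith
  have hn' : (0 : ℝ) < n := by exact_mod_cast hn
  have hn1 : (1 : ℝ) ≤ n := by exact_mod_cast hn
  have hh : 0 < h := lt_of_lt_of_le (by positivity) h1
  have hc₂ : 0 ≤ c₂ := by
    by_contra hneg
    have := mul_nonpos_of_nonpos_of_nonneg (not_le.1 hneg).le
      (Real.rpow_nonneg hn'.le (-1 / (2 * β + 1)))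
    linarith
  have t1 : a / (n * h) ≤ a / c₁ * (n : ℝ) ^ (-(2 * β) / (1 + 2 * β)) := by
    rw [neg_div, Real.rpow_neg hn'.le, ← div_eq_mul_inv, div_div]
    exact div_le_div_of_nonneg_left ha (by positivity) (le_mul_of_bandwidth hβ0 hn h1)
  have t2 : (n : ℝ) ^ (-min β 1) ≤ (n : ℝ) ^ (-(2 * β) / (1 + 2 * β)) := by
    refine Real.rpow_le_rpow_of_exponent_le hn1 ?_
    rw [neg_div]
    refine neg_le_neg (le_min ?_ ?_)
    · rw [div_le_iff₀ (by positivity)]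
      nlinarith
    · rw [div_le_one (by positivity)]
      linarith
  have t3 : (h ^ β) ^ 2 ≤ (c₂ ^ β) ^ 2 * (n : ℝ) ^ (-(2 * β) / (1 + 2 * β)) := by
    have h3 := pow_le_pow_left₀ (by positivity) (Real.rpow_le_rpow hh.le h2 hβ0.le) 2
    refine h3.trans (le_of_eq ?_)
    rw [Real.mul_rpow hc₂ (by positivity), mul_pow, ← Real.rpow_mul hn'.le,
      ← Real.rpow_natCast ((n : ℝ) ^ _) 2, ← Real.rpow_mul hn'.le]
    congr 2
    push_cast
    field_simp
    ring
  nlinarith [mul_le_mul_of_nonneg_left t2 hb, mul_le_mul_of_nonneg_left t3 hd]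

/-! ### The rate of convergence -/

theorem mainTheorem5 (β : ℝ) (hβ : 1 / 2 ≤ β) (K : ℝ → ℝ) (hK : IsLocalPolyKernel K)
    (c₁ c₂ : ℝ) (hc₁ : 0 < c₁) (hc : c₁ ≤ c₂) :
    ∃ n₀ : ℕ, 1 ≤ n₀ ∧
      -- for `n ≥ n₀` the estimator is well defined: the minimizer exists and is unique
      (∀ n : ℕ, n₀ ≤ n → ∀ h : ℝ,
        c₁ * (n : ℝ) ^ (-1 / (2 * β + 1)) ≤ h → h ≤ c₂ * (n : ℝ) ^ (-1 / (2 * β + 1)) →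
        ∀ y : Fin n → ℝ, ∀ t ∈ Icc (0 : ℝ) 1, ∃! θ, IsLocalPolyFit (strictFloor β) K h y t θ) ∧
      -- the rate, uniformly over the function class, the bandwidth and the probability space
      ∀ (L B : ℝ) (σ : ℝ≥0), ∃ C : ℝ, 0 < C ∧
        ∀ n : ℕ, n₀ ≤ n → ∀ h : ℝ,
        c₁ * (n : ℝ) ^ (-1 / (2 * β + 1)) ≤ h → h ≤ c₂ * (n : ℝ) ^ (-1 / (2 * β + 1)) →
        ∀ f ∈ holderClass β L, (1 < β → ∀ t ∈ Icc (0 : ℝ) 1, |f t| ≤ B) →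
        ∀ (Ω : Type*) [MeasurableSpace Ω] (P : Measure Ω) [IsProbabilityMeasure P]
          (x z : Fin n → Ω → ℝ),
          (∀ i, HasLaw (x i) (volume.restrict (Icc (0 : ℝ) 1)) P) →
          (∀ i, HasLaw (z i) (gaussianReal 0 (σ ^ 2)) P) →
          iIndepFun (Sum.elim x z) P →
          let loss : Ω → ℝ := fun ω =>
            empiricalNormSq (fun i => x i ω) (fun t =>
              modifiedLocalPoly (strictFloor β) K h (fun i => x i ω)
                (fun i => f (x i ω) + z i ω) t - f t)
          Integrable loss P ∧ ∫ ω, loss ω ∂P ≤ C * (n : ℝ) ^ (-(2 * β) / (1 + 2 * β)) := by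
  have hβ0 : 0 < β := by linarith
  obtain ⟨c, hc0, Δ, hΔ, hco⟩ := exists_pos_mul_le_sum_sq_mul_kernel (strictFloor β) hK
  obtain ⟨Kmax, hKmax⟩ := hK.bounded
  have hKmax' : ∀ u, K u ≤ Kmax := fun u => (le_abs_self _).trans (hKmax u)
  have hKmax0 : 0 ≤ Kmax := (hK.nonneg 0).trans (hKmax' 0)
  obtain ⟨n₀, hn₀, H⟩ := exists_forall_bandwidth (c₂ := c₂)
    (A := max 1 (((strictFloor β : ℝ) + 1) / Δ)) hβ0 hc₁ hΔ
  have hcoercive : ∀ n : ℕ, n₀ ≤ n → ∀ h : ℝ, c₁ * (n : ℝ) ^ (-1 / (2 * β + 1)) ≤ h →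
      h ≤ c₂ * (n : ℝ) ^ (-1 / (2 * β + 1)) → 0 < h ∧ 1 ≤ n * h ∧ ∀ t ∈ Icc (0 : ℝ) 1,
        ∀ v : Fin (strictFloor β + 1) → ℝ, c * (n * h) * (v ⬝ᵥ v) ≤ ∑ i : Fin n,
          (v ⬝ᵥ monomialVec (strictFloor β) ((pseudoDesign n i - t) / h)) ^ 2
            * K ((pseudoDesign n i - t) / h) := by
    intro n hn h h1 h2
    obtain ⟨h3, h4, h5⟩ := H n hn h h1 h2
    refine ⟨h3, (le_max_left _ _).trans h5, hco n h h3 h4 ?_⟩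
    have h6 := (le_max_right _ _).trans h5
    rw [div_le_iff₀ hΔ] at h6
    nlinarith [mul_pos hΔ h3]
  refine ⟨n₀, hn₀, fun n hn h h1 h2 y t ht => ?_, fun L B σ => ?_⟩
  · obtain ⟨h3, h4, h5⟩ := hcoercive n hn h h1 h2
    exact existsUnique_isLocalPolyFit (mul_pos hc0 (zero_lt_one.trans_le h4)) (h5 t ht) y
  obtain ⟨M, hM⟩ := exists_abs_sub_le_of_mem_holderClass (β := β) B (abs_nonneg L)
  refine ⟨Kmax / c * (3 * σ ^ 2 / c₁ + 72 * M ^ 2 + 15 * |L| ^ 2 * (c₂ ^ β) ^ 2) + 1,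
    by positivity, ?_⟩
  intro n hn h h1 h2 f hf hB Ω _ P _ x z hx hz hind loss
  have hf' := holderClass_mono (le_abs_self L) hf
  obtain ⟨h3, h4, h5⟩ := hcoercive n hn h h1 h2
  obtain ⟨x', z', hx', hzm, hz', hzind, hxz, hxe, hze⟩ := exists_isUniformSample_ae_eq hx hz hind
  obtain ⟨hint, hle⟩ := hx'.integrable_loss_and_integral_le hzm hz' hzind hxz hβ0 (abs_nonneg L) hf'
    (hM f hf' hB) hK hKmax' h3 h4 hc0 h5
  have hae : (fun ω => empiricalNormSq (fun i => x' i ω) (fun t =>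
      modifiedLocalPoly (strictFloor β) K h (fun i => x' i ω)
        (fun i => f (x' i ω) + z' i ω) t - f t)) =ᵐ[P] loss := by
    filter_upwards [ae_all_iff.2 hxe, ae_all_iff.2 hze] with ω hω1 hω2
    simp only [loss, hω1, hω2]
  refine ⟨hint.congr hae, ?_⟩
  rw [← integral_congr_ae hae]
  have hnpos : 0 < n := hn₀.trans hn
  have hrate := risk_bound_le_rate hβ hc₁ (show (0 : ℝ) ≤ 3 * σ ^ 2 by positivity)
    (show 0 ≤ 72 * M ^ 2 by positivity) (show 0 ≤ 15 * |L| ^ 2 by positivity) hnpos h1 h2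
  refine hle.trans ((mul_le_mul_of_nonneg_left hrate (div_nonneg hKmax0 hc0.le)).trans ?_)
  have : 0 ≤ (n : ℝ) ^ (-(2 * β) / (1 + 2 * β)) := by positivity
  linarith
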